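/- Let $\mu$ be a $\sigma$-finite measure on a measurable space $\mathbb{Y}$, let $h:\mathbb{Y}\to[0,\infty)$ and $T:\mathbb{Y}\to\mathbb{R}$ be measurable with $h$ not $\mu$-a.e. zero, and suppose that $\mathcal{D}=\{\theta\in\mathbb{R}:\int h(y)e^{\theta T(y)}\mu(dy)<\infty\}$ is open. For $\theta\in\mathcal D$ put $f_\theta(y)=c(\theta)h(y)e^{\theta T(y)}$ with $c(\theta)^{-1}=\int h(y)e^{\theta T(y)}\mu(dy)$, and let $P_\theta$ be the probability measure with density $f_\theta$ with respect to $\mu$. Let $\Theta_0=[a,b]$ with $a\le b$, $\Theta=[-K,K]\subset\mathcal D$ with $K>\max\{|a|,|b|\}$, and $\Theta_1=\Theta\setminus\Theta_0$. Let $\Lambda_1$ be a probability measure on $\Theta_1$, let $\alpha\in(0,1)$, and let $g:[0,1]\to\mathbb{R}$ be continuous on $[0,1]$ and continuously differentiable on $(0,1)$ with $g'(t)>0$ for $0<t<1$. For a decision rule $\delta$, that is, a measurable function $\delta:\mathbb{Y}\to[0,1]$, write $p(\theta;\delta)=\int\delta(y)f_\theta(y)\,\mu(dy)$. Consider the problem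 $$\max_{\delta}\int_{\Theta_1}g(p(\theta;\delta))\,\Lambda_1(d\theta)\quad\text{subject to}\quad\sup_{\theta\in\Theta_0}p(\theta;\delta)\le\alpha,$$ where $\delta$ ranges over all decision rules. Suppose that $T$ takes more than two values: $\mu(\{y: T(y)\notin\{c_1,c_2\}\})>0$ for all $c_1,c_2\in\mathbb{R}$. Then there is an optimal rule $\delta^*$ for this problem such that $$\sup_{\theta\in[a,b]}p(\theta;\delta^*)=\alpha=\max\{p(a;\delta^*),p(b;\delta^*)\}$$ and such that, for some $-\infty\le\ell\le u\le\infty$ and some measurable $\gamma:\mathbb{Y}\to[0,1]$, for every $y\in\mathbb{Y}$, $$\delta^*(y)=\begin{cases}1,&\text{if }T(y)>u\text{ or }T(y)<\ell,\\ \gamma(y),&\text{if }T(y)\in\{\ell,u\},\\ 0,&\text{if }\ell<T(y)<u.\end{cases}$$ Moreover $\ell<u$, except that possibly $\ell=u=t\in\mathbb{R}$ where $t$ is an atom of the law of $T$ that is not isolated on either side: for every $\theta\in\Theta$, $P_\theta(T=t)>0$, and $P_\theta(t-\varepsilon<T<t)>0$ and $P_\theta(t<T<t+\varepsilon)>0$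 for every $\varepsilon>0$. -/

import Mathlib

open MeasureTheory Set

noncomputable section

namespace CompositeTest

/-- A randomized decision rule: a measurable function with values in `[0, 1]`;
`δ y` is the probability of rejecting the null hypothesis when `y` is observed. -/
def IsDecisionRule {Y : Type*} [MeasurableSpace Y] (δ : Y → ℝ) : Prop :=
  Measurable δ ∧ ∀ y, δ y ∈ Icc (0 : ℝ) 1

/-- The power `p(θ; δ) = E_θ[δ(Y)] = ∫ δ(y) f_θ(y) μ(dy)` of the rule `δ` at the parameter `θ`,
for a family `f` of densities with respect to `μ`. -/
def power {Y : Type*} [MeasurableSpace Y] (μ : Measure Y) (f : ℝ → Y → ℝ)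
    (δ : Y → ℝ) (θ : ℝ) : ℝ :=
  ∫ y, δ y * f θ y ∂μ

/-- The objective `∫_{Θ₁} g(p(θ; δ)) Λ₁(dθ)`. -/
def objective {Y : Type*} [MeasurableSpace Y] (μ : Measure Y) (f : ℝ → Y → ℝ)
    (g : ℝ → ℝ) (Θ₁ : Set ℝ) (Λ₁ : Measure ℝ) (δ : Y → ℝ) : ℝ :=
  ∫ θ in Θ₁, g (power μ f δ θ) ∂Λ₁

/-- The worst-case false-alarm probability `sup_{θ ∈ Θ₀} p(θ; δ)`. -/
def worstFalseAlarm {Y : Type*} [MeasurableSpace Y] (μ : Measure Y) (f : ℝ → Y → ℝ)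
    (Θ₀ : Set ℝ) (δ : Y → ℝ) : ℝ :=
  sSup (power μ f δ '' Θ₀)

/-- Feasible rules of the problem with supremum false-alarm control at level `α`. -/
def IsFeasible {Y : Type*} [MeasurableSpace Y] (μ : Measure Y) (f : ℝ → Y → ℝ)
    (Θ₀ : Set ℝ) (α : ℝ) (δ : Y → ℝ) : Prop :=
  IsDecisionRule δ ∧ worstFalseAlarm μ f Θ₀ δ ≤ α

/-- Optimal rules of the problem: maximize `∫_{Θ₁} g(p(θ; δ)) Λ₁(dθ)` over all rules `δ`
subject to `sup_{θ ∈ Θ₀} p(θ; δ) ≤ α`. -/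
def IsOptimal {Y : Type*} [MeasurableSpace Y] (μ : Measure Y) (f : ℝ → Y → ℝ)
    (g : ℝ → ℝ) (Θ₀ Θ₁ : Set ℝ) (Λ₁ : Measure ℝ) (α : ℝ) (δ : Y → ℝ) : Prop :=
  IsFeasible μ f Θ₀ α δ ∧
    ∀ δ' : Y → ℝ, IsFeasible μ f Θ₀ α δ' →
      objective μ f g Θ₁ Λ₁ δ' ≤ objective μ f g Θ₁ Λ₁ δ

/-- The natural parameter domain `{θ : ∫ h(y) exp(θ T(y)) μ(dy) < ∞}`. -/
def expDomain {Y : Type*} [MeasurableSpace Y] (μ : Measure Y) (h T : Y → ℝ) : Set ℝ :=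
  {θ | Integrable (fun y => h y * Real.exp (θ * T y)) μ}

/-- The normalizing factor `c(θ) = (∫ h(y) exp(θ T(y)) μ(dy))⁻¹`. -/
def expNorm {Y : Type*} [MeasurableSpace Y] (μ : Measure Y) (h T : Y → ℝ) (θ : ℝ) : ℝ :=
  (∫ y, h y * Real.exp (θ * T y) ∂μ)⁻¹

/-- The one-parameter exponential family `f_θ(y) = c(θ) h(y) exp(θ T(y))`. -/
def expDensity {Y : Type*} [MeasurableSpace Y] (μ : Measure Y) (h T : Y → ℝ)
    (θ : ℝ) (y : Y) : ℝ :=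
  expNorm μ h T θ * h y * Real.exp (θ * T y)

open Classical in
/-- The interval rule in `T`: reject if `T y > u` or `T y < ℓ`, randomize with probability `γ y`
if `T y ∈ {ℓ, u}`, accept if `ℓ < T y < u`. -/
def intervalRule {Y : Type*} (T : Y → ℝ) (ℓ u : EReal) (γ : Y → ℝ) (y : Y) : ℝ :=
  if u < (T y : EReal) ∨ (T y : EReal) < ℓ then 1
  else if (T y : EReal) = ℓ ∨ (T y : EReal) = u then γ y
  else 0

/-- `t` is an atom of the law of `T` (under any member of the family `c(θ) h exp(θ T) dμ`; all
members have the null sets of `μ` restricted to `{h > 0}`), and this law charges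
`(t - ε, t)` and `(t, t + ε)` for every `ε > 0`. -/
def IsNonisolatedAtom {Y : Type*} [MeasurableSpace Y] (μ : Measure Y) (h T : Y → ℝ)
    (t : ℝ) : Prop :=
  0 < μ {y | 0 < h y ∧ T y = t} ∧
    ∀ ε : ℝ, 0 < ε →
      0 < μ {y | 0 < h y ∧ T y ∈ Ioo (t - ε) t} ∧ 0 < μ {y | 0 < h y ∧ T y ∈ Ioo t (t + ε)}

end CompositeTest

end

open CompositeTest

/-! Since `g` is strictly increasing, only the power function matters, and two-sided tests in `T`
suffice. They are written `1 - U t + U s`, with `U` a chain of one-sided tests indexed by size under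
the tilt at `a`, so they are parametrized by the compact triangle `0 ≤ s ≤ t ≤ 1`.

Complete class (`exists_twoSided_dominating`): given a rule `φ`, slide `(s, t)` along the pairs of
the same size at `a`. By the intermediate value theorem some pair also matches a second moment: the
power at `b` if `a < b`, the slope of the power at `a` if `a = b`. The difference `ψ` of this test
and `φ` is nonnegative outside the acceptance interval and nonpositive inside. The convex function
`exp ((θ - θ₀) t)` minus its chord over that interval has the same signs, so their product is
nonnegative; integrating it bounds the integral of `ψ` at `θ` below by its mass and first moment at
`θ₀`. The matching conditions then make the two-sided test at least as powerful as `φ` outside `[a,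
b]`.

The same chord, applied to the difference with a constant rule, shows that a two-sided test has its
largest power over `[a, b]` at an endpoint (`tiltedPower_le_max_endpoints`). The supremum constraint
thus becomes two closed conditions, at `a` and `b`, and a maximizer exists by compactness
(`exists_twoSided_isOptimal`). Slack in the level could be spent by mixing with the rule `1`, so the
level is exhausted. Finally a one-point acceptance region is widened across a null gap next to it,
unless both sides carry mass (`exists_intervalRule_power_eq`). -/

open Filter Topology

/-! ### One-sided tests and chains of them indexed by size. -/

namespace CompositeTest

/-- A one-sided randomized test function on the line: it jumps from `0` to `1`, with an arbitrary
value at the jump. -/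
def IsUpperStep (v : ℝ → ℝ) : Prop :=
  (∀ x, v x ∈ Icc (0 : ℝ) 1) ∧ ∀ x y, x < y → 0 < v x → v y = 1

namespace IsUpperStep

lemma zero : IsUpperStep (fun _ => 0) :=
  ⟨fun _ => by simp, fun _ _ _ h => absurd h (lt_irrefl _)⟩

lemma one : IsUpperStep (fun _ => 1) :=
  ⟨fun _ => by simp, fun _ _ _ _ => rfl⟩

lemma monotone {v : ℝ → ℝ} (hv : IsUpperStep v) : Monotone v := by
  intro x y hxy
  rcases hxy.eq_or_lt with rfl | hlt
  · exact le_rfl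
  rcases (hv.1 x).1.eq_or_lt with h0 | h0
  · rw [← h0]; exact (hv.1 y).1
  · rw [hv.2 x y hlt h0]; exact (hv.1 x).2

/-- If `v > w` at `x`, then `v > 0` there, so `v = 1` to the right of `x` and `w` cannot overtake
it; two opposite strict inequalities are therefore incompatible. -/
lemma le_total {v w : ℝ → ℝ} (hv : IsUpperStep v) (hw : IsUpperStep w) : v ≤ w ∨ w ≤ v := by
  by_contra hcon
  simp only [not_or, Pi.le_def, not_forall, not_le] at hcon
  obtain ⟨⟨x, hx⟩, ⟨y, hy⟩⟩ := hcon
  rcases lt_trichotomy x y with hlt | rfl | hlt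
  · have h1 := hv.2 x y hlt ((hw.1 x).1.trans_lt hx)
    linarith [(hw.1 y).2]
  · linarith
  · have h1 := hw.2 y x hlt ((hv.1 y).1.trans_lt hy)
    linarith [(hv.1 x).2]

lemma exists_threshold {v : ℝ → ℝ} (hv : IsUpperStep v) :
    ∃ u : EReal, (∀ t : ℝ, u < t → v t = 1) ∧ ∀ t : ℝ, (t : EReal) < u → v t = 0 := by
  refine ⟨sInf ((fun x : ℝ => (x : EReal)) '' {x | 0 < v x}), fun t ht => ?_, fun t ht => ?_⟩
  · obtain ⟨_, ⟨x, hx, rfl⟩, hxt⟩ := sInf_lt_iff.1 ht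
    exact hv.2 x t (EReal.coe_lt_coe_iff.1 hxt) hx
  · by_contra hne
    have hpos : 0 < v t := lt_of_le_of_ne (hv.1 t).1 (Ne.symm hne)
    exact not_le.2 ht (sInf_le ⟨t, hpos, rfl⟩)

/-- The jump sits at the `(1 - s)`-quantile `u`, and randomization at `u` makes up the part of the
size missing from the mass of `(u, ∞)`. -/
lemma exists_integral_eq (ρ : Measure ℝ) [IsProbabilityMeasure ρ] {s : ℝ}
    (hs : s ∈ Ioo (0 : ℝ) 1) : ∃ v, IsUpperStep v ∧ ∫ x, v x ∂ρ = s := by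
  classical
  set F := ProbabilityTheory.cdf ρ with hF
  set A : Set ℝ := {x | 1 - s ≤ F x} with hA
  have hne : A.Nonempty := by
    have := (ProbabilityTheory.tendsto_cdf_atTop ρ).eventually (lt_mem_nhds (show 1 - s < 1 by linarith [hs.1]))
    obtain ⟨x, hx⟩ := this.exists
    exact ⟨x, le_of_lt hx⟩
  have hbdd : BddBelow A := by
    have := (ProbabilityTheory.tendsto_cdf_atBot ρ).eventually (gt_mem_nhds (show 0 < 1 - s by linarith [hs.2]))
    obtain ⟨x, hx⟩ := this.exists
    refine ⟨x, fun y hy => ?_⟩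
    by_contra hlt
    have := F.mono (le_of_lt (not_le.1 hlt))
    exact absurd (hy.trans this) (not_le.2 hx)
  set u := sInf A with hu
  have hFu : 1 - s ≤ F u := by
    have ht : Tendsto F (𝓝[>] u) (𝓝 (F u)) :=
      (F.right_continuous u).mono_left (nhdsWithin_mono _ Ioi_subset_Ici_self)
    refine ge_of_tendsto ht ?_
    filter_upwards [self_mem_nhdsWithin] with x hx
    obtain ⟨y, hy, hyx⟩ := exists_lt_of_csInf_lt hne hx
    exact le_trans hy (F.mono hyx.le)
  have hFl : Function.leftLim F u ≤ 1 - s := by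
    refine le_of_tendsto (F.mono.tendsto_leftLim u) ?_
    filter_upwards [self_mem_nhdsWithin] with x hx
    have hxA : x ∉ A := notMem_of_lt_csInf hx hbdd
    exact le_of_lt (not_le.1 hxA)
  have hIio : ρ.real (Iio u) ≤ 1 - s := by
    have h1 := F.measure_Iio (ProbabilityTheory.tendsto_cdf_atBot ρ) u
    rw [ProbabilityTheory.measure_cdf] at h1
    rw [measureReal_def, h1, sub_zero]
    exact ENNReal.toReal_le_of_le_ofReal (by linarith [hs.2]) (ENNReal.ofReal_le_ofReal hFl)
  have hIic : 1 - s ≤ ρ.real (Iic u) := by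
    rwa [← ProbabilityTheory.cdf_eq_real]
  have hsplit : ρ.real (Iic u) = ρ.real (Iio u) + ρ.real {u} := by
    rw [← Iio_union_right, measureReal_union (by simp) (measurableSet_singleton u)]
  have hIoi : ρ.real (Ioi u) = 1 - ρ.real (Iic u) := by
    rw [← compl_Iic, probReal_compl_eq_one_sub measurableSet_Iic]
  have hnn : 0 ≤ s - ρ.real (Ioi u) := by linarith
  have hle : s - ρ.real (Ioi u) ≤ ρ.real {u} := by linarith
  -- Without an atom at `u` this is `0 / 0 = 0`, which is correct because `hnn` and `hle` then force
  -- the numerator to vanish.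
  set γ := (s - ρ.real (Ioi u)) / ρ.real {u} with hγ
  have hγ0 : 0 ≤ γ := div_nonneg hnn measureReal_nonneg
  have hγ1 : γ ≤ 1 := div_le_one_of_le₀ hle measureReal_nonneg
  have hγm : ρ.real {u} * γ = s - ρ.real (Ioi u) := by
    rcases eq_or_ne (ρ.real {u}) 0 with h0 | h0
    · rw [h0] at hle ⊢; linarith
    · rw [hγ]; field_simp
  refine ⟨fun x => (Ioi u).indicator (fun _ => (1 : ℝ)) x + ({u} : Set ℝ).indicator (fun _ => γ) x,
    ⟨fun x => ?_, fun x y hxy hx => ?_⟩, ?_⟩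
  · rcases lt_trichotomy x u with h | rfl | h
    · simp [h.le, h.ne]
    · simp [hγ0, hγ1]
    · simp [h, h.ne']
  · have hux : u ≤ x := by
      by_contra h
      simp [(not_le.1 h).le, (not_le.1 h).ne] at hx
    have huy : u < y := hux.trans_lt hxy
    simp [huy, huy.ne']
  · rw [integral_add]
    · rw [integral_indicator_const _ measurableSet_Ioi,
        integral_indicator_const _ (measurableSet_singleton u)]
      simp only [smul_eq_mul, mul_one, hγm]; ring
    · exact (integrable_const _).indicator measurableSet_Ioi
    · exact (integrable_const _).indicator (measurableSet_singleton u)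

end IsUpperStep

/-- A chain of one-sided tests based on `T`, indexed by their size under `ν`. -/
structure IsStepFamily {Y : Type*} [MeasurableSpace Y] (ν : Measure Y) (T : Y → ℝ)
    (U : ℝ → ℝ → ℝ) : Prop where
  step : ∀ s, IsUpperStep (U s)
  zero : ∀ x, U 0 x = 0
  one : ∀ x, U 1 x = 1
  integral_eq : ∀ s ∈ Icc (0 : ℝ) 1, ∫ y, U s (T y) ∂ν = s
  mono : ∀ s ∈ Icc (0 : ℝ) 1, ∀ t ∈ Icc (0 : ℝ) 1, s ≤ t → U s ≤ U t

lemma IsUpperStep.measurable_comp {Y : Type*} [MeasurableSpace Y] {T : Y → ℝ} (hT : Measurable T)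
    {v : ℝ → ℝ} (hv : IsUpperStep v) : Measurable fun y => v (T y) :=
  hv.monotone.measurable.comp hT

lemma IsUpperStep.integrable_comp {Y : Type*} [MeasurableSpace Y] (ν : Measure Y)
    [IsFiniteMeasure ν] {T : Y → ℝ} (hT : Measurable T)
    {v : ℝ → ℝ} (hv : IsUpperStep v) : Integrable (fun y => v (T y)) ν :=
  Integrable.of_bound (hv.measurable_comp hT).aestronglyMeasurable 1
    (ae_of_all _ fun y => by
      rw [Real.norm_eq_abs, abs_le]; exact ⟨by linarith [(hv.1 (T y)).1], (hv.1 (T y)).2⟩)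

/-- The tests may be chosen independently for each size: any two are comparable, and their sizes
decide which is the larger. Sizes `0` and `1` get the constant tests, so that equality there is
pointwise. -/
theorem exists_isStepFamily {Y : Type*} [MeasurableSpace Y] (ν : Measure Y)
    [IsProbabilityMeasure ν] {T : Y → ℝ} (hT : Measurable T) : ∃ U, IsStepFamily ν T U := by
  have key : ∀ s : ℝ, ∃ v : ℝ → ℝ, IsUpperStep v ∧ (s = 0 → ∀ x, v x = 0) ∧
      (s = 1 → ∀ x, v x = 1) ∧ (s ∈ Icc (0 : ℝ) 1 → ∫ y, v (T y) ∂ν = s) := by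
    intro s
    by_cases h0 : s = 0
    · exact ⟨fun _ => 0, .zero, fun _ _ => rfl, fun h => by simp [h0] at h, fun _ => by simp [h0]⟩
    by_cases h1 : s = 1
    · exact ⟨fun _ => 1, .one, fun h => absurd h h0, fun _ _ => rfl, fun _ => by simp [h1]⟩
    by_cases hs : s ∈ Icc (0 : ℝ) 1
    · have : IsProbabilityMeasure (ν.map T) := Measure.isProbabilityMeasure_map hT.aemeasurable
      obtain ⟨v, hv, hvs⟩ := IsUpperStep.exists_integral_eq (ν.map T)
        (s := s) ⟨lt_of_le_of_ne hs.1 (Ne.symm h0), lt_of_le_of_ne hs.2 h1⟩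
      rw [integral_map hT.aemeasurable hv.monotone.measurable.aestronglyMeasurable] at hvs
      exact ⟨v, hv, fun h => absurd h h0, fun h => absurd h h1, fun _ => hvs⟩
    · exact ⟨fun _ => 0, .zero, fun _ _ => rfl, fun h => absurd h h1, fun h => absurd h hs⟩
  choose U hU h0 h1 hI using key
  refine ⟨U, hU, h0 0 rfl, h1 1 rfl, hI, fun s hs t ht hst => ?_⟩
  rcases hst.eq_or_lt with rfl | hlt
  · exact le_rfl
  rcases (hU s).le_total (hU t) with h | h
  · exact h
  · have : ∫ y, U t (T y) ∂ν ≤ ∫ y, U s (T y) ∂ν :=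
      integral_mono ((hU t).integrable_comp ν hT) ((hU s).integrable_comp ν hT) fun y => h (T y)
    rw [hI s hs, hI t ht] at this
    linarith

lemma IsUpperStep.integrable_mul {Y : Type*} [MeasurableSpace Y] {ν : Measure Y}
    {T : Y → ℝ} (hT : Measurable T) {w : Y → ℝ} (hw : Integrable w ν)
    {v : ℝ → ℝ} (hv : IsUpperStep v) : Integrable (fun y => v (T y) * w y) ν :=
  hw.bdd_mul (c := 1) (hv.measurable_comp hT).aestronglyMeasurable
    (ae_of_all _ fun y => by
      rw [Real.norm_eq_abs, abs_le]; exact ⟨by linarith [(hv.1 (T y)).1], (hv.1 (T y)).2⟩)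

/-- By monotonicity in the size, the increment is at most `M * ∫ (U t - U s) = M * (t - s)`, so the
map is Lipschitz. -/
lemma IsStepFamily.continuousOn_of_bounded {Y : Type*} [MeasurableSpace Y] {ν : Measure Y}
    [IsProbabilityMeasure ν] {T : Y → ℝ} (hT : Measurable T) {U : ℝ → ℝ → ℝ}
    (hU : IsStepFamily ν T U) {w : Y → ℝ} (hw : Integrable w ν) {M : ℝ} (hM : ∀ y, |w y| ≤ M) :
    ContinuousOn (fun s => ∫ y, U s (T y) * w y ∂ν) (Icc 0 1) := by
  have hM0 : 0 ≤ M := by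
    obtain ⟨y⟩ := nonempty_of_isProbabilityMeasure ν
    exact (abs_nonneg _).trans (hM y)
  have key : ∀ s ∈ Icc (0 : ℝ) 1, ∀ t ∈ Icc (0 : ℝ) 1, s ≤ t →
      |(∫ y, U t (T y) * w y ∂ν) - ∫ y, U s (T y) * w y ∂ν| ≤ M * (t - s) := by
    intro s hs t ht hst
    rw [← integral_sub ((hU.step t).integrable_mul hT hw) ((hU.step s).integrable_mul hT hw)]
    calc |∫ y, (U t (T y) * w y - U s (T y) * w y) ∂ν|
        ≤ ∫ y, M * (U t (T y) - U s (T y)) ∂ν := by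
          refine norm_integral_le_of_norm_le (f := fun y => U t (T y) * w y - U s (T y) * w y)
            (((hU.step t).integrable_comp ν hT).sub ((hU.step s).integrable_comp ν hT)
              |>.const_mul M) (ae_of_all _ fun y => ?_)
          have h1 : 0 ≤ U t (T y) - U s (T y) := sub_nonneg.2 (hU.mono s hs t ht hst (T y))
          rw [Real.norm_eq_abs, ← sub_mul, abs_mul, abs_of_nonneg h1, mul_comm]
          exact mul_le_mul_of_nonneg_right (hM y) h1
      _ = M * (t - s) := by
          rw [integral_const_mul, integral_sub ((hU.step t).integrable_comp ν hT)
            ((hU.step s).integrable_comp ν hT), hU.integral_eq t ht, hU.integral_eq s hs]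
  refine LipschitzOnWith.continuousOn (K := M.toNNReal) (LipschitzOnWith.of_dist_le_mul ?_)
  intro s hs t ht
  rw [Real.coe_toNNReal _ hM0, Real.dist_eq, Real.dist_eq]
  rcases le_total s t with h | h
  · rw [abs_sub_comm, abs_sub_comm s t, abs_of_nonneg (sub_nonneg.2 h)]
    exact key s hs t ht h
  · rw [abs_of_nonneg (sub_nonneg.2 h)]
    exact key t ht s hs h

/-- Truncations of `w` converge in `L¹`, and `0 ≤ U s ≤ 1` makes the convergence of the integrals
uniform in `s`; the bounded case applies to each truncation. -/
theorem IsStepFamily.continuousOn_integral {Y : Type*} [MeasurableSpace Y] {ν : Measure Y}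
    [IsProbabilityMeasure ν] {T : Y → ℝ} (hT : Measurable T) {U : ℝ → ℝ → ℝ}
    (hU : IsStepFamily ν T U) {w : Y → ℝ} (hw : Integrable w ν) :
    ContinuousOn (fun s => ∫ y, U s (T y) * w y ∂ν) (Icc 0 1) := by
  set W : ℕ → Y → ℝ := fun n y => max (-(n : ℝ)) (min (w y) n) with hW
  have hWle : ∀ n y, |W n y| ≤ |w y| := by
    intro n y
    have hn : (0 : ℝ) ≤ n := Nat.cast_nonneg n
    simp only [hW]
    rcases abs_cases (w y) with h | h <;> rw [abs_le] <;> constructor <;>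
      grind
  have hWn : ∀ n y, |W n y| ≤ n := by
    intro n y
    have hn : (0 : ℝ) ≤ n := Nat.cast_nonneg n
    simp only [hW]
    rw [abs_le]; constructor <;> grind
  have hWm : ∀ n, AEStronglyMeasurable (W n) ν := fun n =>
    (aestronglyMeasurable_const.sup (hw.1.inf aestronglyMeasurable_const))
  have hWi : ∀ n, Integrable (W n) ν := fun n =>
    hw.mono (hWm n) (ae_of_all _ fun y => by simpa using hWle n y)
  have hlim : Tendsto (fun n => ∫ y, |w y - W n y| ∂ν) atTop (𝓝 0) := by
    have := tendsto_integral_of_dominated_convergence (μ := ν) (F := fun n y => |w y - W n y|)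
      (f := fun _ => (0 : ℝ)) (fun y => 2 * |w y|)
      (fun n => (hw.1.sub (hWm n)).norm)
      (hw.abs.const_mul 2)
      (fun n => ae_of_all _ fun y => by
        rw [Real.norm_eq_abs, abs_abs]
        linarith [abs_sub (w y) (W n y), hWle n y])
      (ae_of_all _ fun y => by
        refine tendsto_const_nhds.congr' ?_
        filter_upwards [eventually_ge_atTop ⌈|w y|⌉₊] with n hn
        have h1 : |w y| ≤ n := (Nat.le_ceil _).trans (by exact_mod_cast hn)
        rw [abs_le] at h1
        simp only [hW]
        rw [min_eq_left h1.2, max_eq_right h1.1]; simp)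
    simpa using this
  have hunif : TendstoUniformlyOn (fun (n : ℕ) s => ∫ y, U s (T y) * W n y ∂ν)
      (fun s => ∫ y, U s (T y) * w y ∂ν) atTop (Icc 0 1) := by
    rw [Metric.tendstoUniformlyOn_iff]
    intro ε hε
    filter_upwards [hlim.eventually (gt_mem_nhds hε)] with n hn s _
    refine lt_of_le_of_lt ?_ hn
    rw [Real.dist_eq, ← integral_sub ((hU.step s).integrable_mul hT hw)
      ((hU.step s).integrable_mul hT (hWi n))]
    refine norm_integral_le_of_norm_le (f := fun y => U s (T y) * w y - U s (T y) * W n y)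
      (hw.sub (hWi n)).abs (ae_of_all _ fun y => ?_)
    rw [Real.norm_eq_abs, ← mul_sub, abs_mul, abs_of_nonneg ((hU.step s).1 _).1]
    exact mul_le_of_le_one_left (abs_nonneg _) ((hU.step s).1 _).2
  exact hunif.continuousOn (Frequently.of_forall fun n =>
    hU.continuousOn_of_bounded hT (hWi n) (hWn n))

end CompositeTest

/-! ### Two-sided tests, moment matching and the exponential chord. -/

namespace CompositeTest

lemma IsDecisionRule.integrable_mul {Y : Type*} [MeasurableSpace Y] {m : Measure Y}
    {φ : Y → ℝ} (hφ : IsDecisionRule φ) {w : Y → ℝ} (hw : Integrable w m) :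
    Integrable (fun y => φ y * w y) m :=
  hw.bdd_mul (c := 1) hφ.1.aestronglyMeasurable
    (ae_of_all _ fun y => by
      rw [Real.norm_eq_abs, abs_le]; exact ⟨by linarith [(hφ.2 y).1], (hφ.2 y).2⟩)

lemma IsDecisionRule.integrable {Y : Type*} [MeasurableSpace Y] {m : Measure Y}
    [IsFiniteMeasure m] {φ : Y → ℝ} (hφ : IsDecisionRule φ) : Integrable φ m := by
  simpa using hφ.integrable_mul (integrable_const (1 : ℝ) (μ := m))

lemma IsDecisionRule.one_sub {Y : Type*} [MeasurableSpace Y]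
    {φ : Y → ℝ} (hφ : IsDecisionRule φ) : IsDecisionRule (fun y => 1 - φ y) :=
  ⟨measurable_const.sub hφ.1, fun y => ⟨by linarith [(hφ.2 y).2], by linarith [(hφ.2 y).1]⟩⟩

lemma IsUpperStep.isDecisionRule {Y : Type*} [MeasurableSpace Y] {T : Y → ℝ} (hT : Measurable T)
    {v : ℝ → ℝ} (hv : IsUpperStep v) : IsDecisionRule (fun y => v (T y)) :=
  ⟨hv.measurable_comp hT, fun y => hv.1 (T y)⟩

/-- Among tests of a given size, a one-sided test maximizes the integral of a monotone function. -/
lemma IsUpperStep.integral_mul_le {Y : Type*} [MeasurableSpace Y] {ν : Measure Y}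
    [IsFiniteMeasure ν] {T : Y → ℝ} (hT : Measurable T) {X : ℝ → ℝ} (hX : Monotone X)
    (hXi : Integrable (fun y => X (T y)) ν) {v : ℝ → ℝ} (hv : IsUpperStep v) {φ : Y → ℝ}
    (hφ : IsDecisionRule φ) (heq : ∫ y, v (T y) ∂ν = ∫ y, φ y ∂ν) :
    ∫ y, φ y * X (T y) ∂ν ≤ ∫ y, v (T y) * X (T y) ∂ν := by
  have hvr := hv.isDecisionRule hT
  obtain ⟨u, h1, h0⟩ := hv.exists_threshold
  induction u using EReal.rec with
  | bot =>
    have hv1 : ∀ y, v (T y) = 1 := fun y => h1 _ (EReal.bot_lt_coe _)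
    have : (fun y => 1 - φ y) =ᵐ[ν] 0 := by
      rw [← integral_eq_zero_iff_of_nonneg (fun y => (hφ.one_sub.2 y).1) hφ.one_sub.integrable,
        integral_sub (integrable_const _) hφ.integrable, ← heq]
      simp [hv1]
    refine (integral_congr_ae ?_).le
    filter_upwards [this] with y hy
    have : φ y = 1 := by simp only [Pi.zero_apply] at hy; linarith
    rw [this, hv1]
  | top =>
    have hv0 : ∀ y, v (T y) = 0 := fun y => h0 _ (EReal.coe_lt_top _)
    have : φ =ᵐ[ν] 0 := by
      rw [← integral_eq_zero_iff_of_nonneg (fun y => (hφ.2 y).1) hφ.integrable, ← heq]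
      simp [hv0]
    refine (integral_congr_ae ?_).le
    filter_upwards [this] with y hy
    rw [hy, hv0]; simp
  | coe u =>
    -- Neyman–Pearson argument: both factors change sign at the jump `u`, and the constant `X u`
    -- drops out because the sizes agree.
    have hnn : 0 ≤ ∫ y, (v (T y) - φ y) * (X (T y) - X u) ∂ν := by
      refine integral_nonneg fun y => ?_
      rcases lt_trichotomy (T y) u with h | h | h
      · rw [h0 _ (EReal.coe_lt_coe_iff.2 h)]
        exact mul_nonneg_of_nonpos_of_nonpos (by linarith [(hφ.2 y).1])
          (sub_nonpos.2 (hX h.le))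
      · simp [h]
      · rw [h1 _ (EReal.coe_lt_coe_iff.2 h)]
        exact mul_nonneg (by linarith [(hφ.2 y).2]) (sub_nonneg.2 (hX h.le))
    have hexp : ∀ y, (v (T y) - φ y) * (X (T y) - X u) =
        (v (T y) * X (T y) - φ y * X (T y)) - (v (T y) - φ y) * X u := fun y => by ring
    have i1 := hvr.integrable_mul hXi
    have i2 := hφ.integrable_mul hXi
    have i3 := (hvr.integrable (m := ν)).sub hφ.integrable
    simp_rw [hexp] at hnn
    rw [integral_sub (f := fun y => v (T y) * X (T y) - φ y * X (T y))
      (g := fun y => (v (T y) - φ y) * X u) (i1.sub i2) (i3.mul_const (X u)), integral_sub i1 i2,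
      integral_mul_const, integral_sub hvr.integrable hφ.integrable, heq] at hnn
    linarith

/-- The two-sided test accepting between the jumps of the one-sided tests `U t` and `U s`. -/
def twoSided {Y : Type*} (T : Y → ℝ) (U : ℝ → ℝ → ℝ) (s t : ℝ) (y : Y) : ℝ :=
  1 - U t (T y) + U s (T y)

/-- The pairs `(s, t)` with `0 ≤ s ≤ t ≤ 1`. -/
def sizePairs : Set (ℝ × ℝ) := {q | 0 ≤ q.1 ∧ q.1 ≤ q.2 ∧ q.2 ≤ 1}

lemma isCompact_sizePairs : IsCompact sizePairs := by
  refine (isCompact_Icc (a := ((0 : ℝ), (0 : ℝ))) (b := (1, 1))).of_isClosed_subset ?_ ?_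
  · exact (isClosed_le continuous_const continuous_fst).inter
      ((isClosed_le continuous_fst continuous_snd).inter
        (isClosed_le continuous_snd continuous_const))
  · rintro ⟨s, t⟩ ⟨h1, h2, h3⟩
    simp only at h1 h2 h3
    exact ⟨⟨h1, h1.trans h2⟩, ⟨h2.trans h3, h3⟩⟩

lemma fst_mem_of_mem_sizePairs {q : ℝ × ℝ} (hq : q ∈ sizePairs) : q.1 ∈ Icc (0 : ℝ) 1 :=
  ⟨hq.1, hq.2.1.trans hq.2.2⟩

lemma snd_mem_of_mem_sizePairs {q : ℝ × ℝ} (hq : q ∈ sizePairs) : q.2 ∈ Icc (0 : ℝ) 1 :=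
  ⟨hq.1.trans hq.2.1, hq.2.2⟩

section StepFamily

variable {Y : Type*} [MeasurableSpace Y] {ν : Measure Y} {T : Y → ℝ} {U : ℝ → ℝ → ℝ}

lemma IsStepFamily.isDecisionRule_twoSided (hU : IsStepFamily ν T U) (hT : Measurable T)
    {q : ℝ × ℝ} (hq : q ∈ sizePairs) : IsDecisionRule (twoSided T U q.1 q.2) := by
  refine ⟨(measurable_const.sub ((hU.step _).measurable_comp hT)).add
    ((hU.step _).measurable_comp hT), fun y => ?_⟩
  have h1 := hU.mono _ (fst_mem_of_mem_sizePairs hq) _ (snd_mem_of_mem_sizePairs hq) hq.2.1 (T y)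
  have h2 := (hU.step q.1).1 (T y)
  have h3 := (hU.step q.2).1 (T y)
  unfold twoSided
  exact ⟨by linarith [h2.1, h3.2], by linarith⟩

/-- The larger test `U q.2` jumps earlier, so its threshold is the lower end `ℓ`. -/
lemma IsStepFamily.exists_thresholds (hU : IsStepFamily ν T U) {q : ℝ × ℝ}
    (hq : q ∈ sizePairs) : ∃ ℓ u : EReal, ℓ ≤ u ∧
      (∀ y, (T y : EReal) < ℓ ∨ u < (T y : EReal) → twoSided T U q.1 q.2 y = 1) ∧
      ∀ y, ℓ < (T y : EReal) → (T y : EReal) < u → twoSided T U q.1 q.2 y = 0 := by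
  have hle := hU.mono _ (fst_mem_of_mem_sizePairs hq) _ (snd_mem_of_mem_sizePairs hq) hq.2.1
  obtain ⟨u, u1, u0⟩ := (hU.step q.1).exists_threshold
  obtain ⟨ℓ, l1, l0⟩ := (hU.step q.2).exists_threshold
  refine ⟨ℓ, u, ?_, ?_, fun y h1 h2 => ?_⟩
  · by_contra hlt
    obtain ⟨x, hx1, hx2⟩ := EReal.lt_iff_exists_real_btwn.1 (not_le.1 hlt)
    have := hle x
    rw [u1 x hx1, l0 x hx2] at this
    linarith
  · rintro y (hy | hy)
    · have h1 := hle (T y)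
      have h2 := ((hU.step q.1).1 (T y)).1
      rw [l0 _ hy] at h1
      simp [twoSided, l0 _ hy, le_antisymm h1 h2]
    · have h1 := hle (T y)
      have h2 := ((hU.step q.2).1 (T y)).2
      rw [u1 _ hy] at h1
      simp [twoSided, u1 _ hy, le_antisymm h2 h1]
  · simp [twoSided, l1 _ h1, u0 _ h2]

lemma IsStepFamily.integral_twoSided_mul (hU : IsStepFamily ν T U) (hT : Measurable T)
    {w : Y → ℝ} (hw : Integrable w ν) (s t : ℝ) :
    ∫ y, twoSided T U s t y * w y ∂ν =
      ∫ y, w y ∂ν - ∫ y, U t (T y) * w y ∂ν + ∫ y, U s (T y) * w y ∂ν := by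
  have i1 := (hU.step t).integrable_mul hT hw
  have i2 := (hU.step s).integrable_mul hT hw
  rw [← integral_sub hw i1, ← integral_add (f := fun y => w y - U t (T y) * w y) (hw.sub i1) i2]
  refine integral_congr_ae (ae_of_all _ fun y => ?_)
  simp only [twoSided]; ring

lemma IsStepFamily.continuousOn_twoSided [IsProbabilityMeasure ν] (hU : IsStepFamily ν T U)
    (hT : Measurable T) {w : Y → ℝ} (hw : Integrable w ν) :
    ContinuousOn (fun q : ℝ × ℝ => ∫ y, twoSided T U q.1 q.2 y * w y ∂ν) sizePairs := by
  simp_rw [hU.integral_twoSided_mul hT hw]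
  have hc := hU.continuousOn_integral hT hw
  exact (continuousOn_const.sub (hc.comp continuousOn_snd fun q => snd_mem_of_mem_sizePairs)).add
    (hc.comp continuousOn_fst fun q => fst_mem_of_mem_sizePairs)

/-- Every test has a two-sided test with the same size and the same moment of `X ∘ T`. -/
theorem IsStepFamily.exists_twoSided_matching [IsProbabilityMeasure ν] (hU : IsStepFamily ν T U)
    (hT : Measurable T) {X : ℝ → ℝ} (hX : Monotone X) (hXi : Integrable (fun y => X (T y)) ν)
    {φ : Y → ℝ} (hφ : IsDecisionRule φ) : ∃ q ∈ sizePairs,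
      ∫ y, twoSided T U q.1 q.2 y ∂ν = ∫ y, φ y ∂ν ∧
      ∫ y, twoSided T U q.1 q.2 y * X (T y) ∂ν = ∫ y, φ y * X (T y) ∂ν := by
  set p := ∫ y, φ y ∂ν with hp
  have hp0 : 0 ≤ p := integral_nonneg fun y => (hφ.2 y).1
  have hp1 : p ≤ 1 := by
    have := integral_mono (hφ.integrable (m := ν)) (integrable_const 1) fun y => (hφ.2 y).2
    simpa using this
  -- Size `p` forces `t = 1 - p + s`. At `s = 0` the test rejects only for small `T` and has the
  -- least moment; at `s = p` it rejects only for large `T` and has the greatest.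
  have hmem : ∀ s ∈ Icc 0 p, (s, 1 - p + s) ∈ sizePairs := fun s hs =>
    ⟨hs.1, by simp only; linarith, by simp only; linarith [hs.2]⟩
  have hcont : ContinuousOn
      (fun s : ℝ => ∫ y, twoSided T U s (1 - p + s) y * X (T y) ∂ν) (Icc 0 p) :=
    (hU.continuousOn_twoSided hT hXi).comp
      (f := fun s : ℝ => (s, 1 - p + s)) (by fun_prop) hmem
  have hlow : ∫ y, twoSided T U 0 (1 - p + 0) y * X (T y) ∂ν ≤ ∫ y, φ y * X (T y) ∂ν := by
    rw [hU.integral_twoSided_mul hT hXi]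
    have := (hU.step (1 - p + 0)).integral_mul_le hT hX hXi hφ.one_sub (by
      rw [hU.integral_eq _ ⟨by linarith, by linarith⟩,
        integral_sub (integrable_const _) hφ.integrable]
      simp [hp])
    simp_rw [sub_mul, one_mul] at this
    rw [integral_sub hXi (hφ.integrable_mul hXi)] at this
    simp only [hU.zero, zero_mul, integral_zero]
    linarith
  have hhigh : ∫ y, φ y * X (T y) ∂ν ≤ ∫ y, twoSided T U p (1 - p + p) y * X (T y) ∂ν := by
    rw [hU.integral_twoSided_mul hT hXi, show 1 - p + p = 1 by ring]
    have := (hU.step p).integral_mul_le hT hX hXi hφ (hU.integral_eq p ⟨hp0, hp1⟩)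
    simp only [hU.one, one_mul]
    linarith
  obtain ⟨s, hs, hse⟩ := intermediate_value_Icc hp0 hcont ⟨hlow, hhigh⟩
  refine ⟨(s, 1 - p + s), hmem s hs, ?_, hse⟩
  have := hU.integral_twoSided_mul hT (integrable_const (1 : ℝ)) s (1 - p + s)
  simp only [mul_one] at this
  rw [this, hU.integral_eq _ (fst_mem_of_mem_sizePairs (hmem s hs)),
    hU.integral_eq _ (snd_mem_of_mem_sizePairs (hmem s hs))]
  simp only [integral_const, probReal_univ, smul_eq_mul, mul_one]
  ring

end StepFamily

/-- The sign pattern of the difference between a two-sided test and another test. -/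
def IsTwoSidedSign {Y : Type*} (T ψ : Y → ℝ) (ℓ u : EReal) : Prop :=
  ℓ ≤ u ∧ (∀ y, (T y : EReal) < ℓ ∨ u < (T y : EReal) → 0 ≤ ψ y) ∧
    ∀ y, ℓ < (T y : EReal) → (T y : EReal) < u → ψ y ≤ 0

/-- Infinite thresholds leave at most one sign change, which needs only monotonicity; the chord is
reserved for two finite thresholds. -/
lemma IsTwoSidedSign.cases {Y : Type*} {T ψ : Y → ℝ} {ℓ u : EReal}
    (h : IsTwoSidedSign T ψ ℓ u) :
    (∃ r s : ℝ, r ≤ s ∧ (∀ y, T y < r ∨ s < T y → 0 ≤ ψ y) ∧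
      ∀ y, r < T y → T y < s → ψ y ≤ 0) ∨
    (∃ r : ℝ, ∀ y, 0 ≤ ψ y * (T y - r)) ∨ (∃ r : ℝ, ∀ y, ψ y * (T y - r) ≤ 0) ∨
    (∀ y, 0 ≤ ψ y) ∨ ∀ y, ψ y ≤ 0 := by
  obtain ⟨hle, hout, hin⟩ := h
  induction ℓ using EReal.rec with
  | bot =>
    induction u using EReal.rec with
    | bot => exact .inr (.inr (.inr (.inl fun y => hout y (.inr (EReal.bot_lt_coe _)))))
    | top =>
      exact .inr (.inr (.inr (.inr fun y => hin y (EReal.bot_lt_coe _) (EReal.coe_lt_top _))))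
    | coe u =>
      refine .inr (.inl ⟨u, fun y => ?_⟩)
      rcases lt_trichotomy (T y) u with h | h | h
      · exact mul_nonneg_of_nonpos_of_nonpos
          (hin y (EReal.bot_lt_coe _) (EReal.coe_lt_coe_iff.2 h)) (by linarith)
      · simp [h]
      · exact mul_nonneg (hout y (.inr (EReal.coe_lt_coe_iff.2 h))) (by linarith)
  | top => exact .inr (.inr (.inr (.inl fun y => hout y (.inl (EReal.coe_lt_top _)))))
  | coe r =>
    induction u using EReal.rec with
    | bot => simp at hle
    | top =>
      refine .inr (.inr (.inl ⟨r, fun y => ?_⟩))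
      rcases lt_trichotomy (T y) r with h | h | h
      · exact mul_nonpos_of_nonneg_of_nonpos
          (hout y (.inl (EReal.coe_lt_coe_iff.2 h))) (by linarith)
      · simp [h]
      · exact mul_nonpos_of_nonpos_of_nonneg
          (hin y (EReal.coe_lt_coe_iff.2 h) (EReal.coe_lt_top _)) (by linarith)
    | coe s =>
      exact .inl ⟨r, s, EReal.coe_le_coe_iff.1 hle, fun y hy => hout y (by simpa using hy),
        fun y h1 h2 => hin y (EReal.coe_lt_coe_iff.2 h1) (EReal.coe_lt_coe_iff.2 h2)⟩

/-- The chord of `t ↦ exp (κ t)` through `r ≤ s`, or its tangent if `r = s`. -/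
lemma exists_exp_chord (κ : ℝ) {r s : ℝ} (hrs : r ≤ s) :
    ∃ c : ℝ, (0 < κ → 0 < c) ∧ (κ < 0 → c < 0) ∧
      (∀ t, t ≤ r ∨ s ≤ t → 0 ≤ Real.exp (κ * t) - Real.exp (κ * r) - c * (t - r)) ∧
      ∀ t, r ≤ t → t ≤ s → Real.exp (κ * t) - Real.exp (κ * r) - c * (t - r) ≤ 0 := by
  rcases hrs.eq_or_lt with rfl | hlt
  · have key : ∀ t, 0 ≤ Real.exp (κ * t) - Real.exp (κ * r) - κ * Real.exp (κ * r) * (t - r) := by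
      intro t
      have h1 := Real.add_one_le_exp (κ * (t - r))
      have h2 : Real.exp (κ * t) = Real.exp (κ * r) * Real.exp (κ * (t - r)) := by
        rw [← Real.exp_add]; ring_nf
      rw [h2]
      nlinarith [mul_le_mul_of_nonneg_left h1 (Real.exp_pos (κ * r)).le]
    refine ⟨κ * Real.exp (κ * r), fun h => mul_pos h (Real.exp_pos _),
      fun h => mul_neg_of_neg_of_pos h (Real.exp_pos _), fun t _ => key t, fun t h1 h2 => ?_⟩
    rw [le_antisymm h2 h1]; simp
  · have hconv : ConvexOn ℝ univ fun t : ℝ => Real.exp (κ * t) := by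
      have := convexOn_exp.comp_linearMap (LinearMap.mul ℝ ℝ κ)
      simpa [Function.comp_def] using this
    have hsr : 0 < s - r := sub_pos.2 hlt
    set c := (Real.exp (κ * s) - Real.exp (κ * r)) / (s - r) with hc
    have hcs : c * (s - r) = Real.exp (κ * s) - Real.exp (κ * r) := by
      rw [hc]; field_simp
    refine ⟨c, fun h => div_pos (sub_pos.2 (Real.exp_lt_exp.2 (by nlinarith))) hsr,
      fun h => div_neg_of_neg_of_pos (sub_neg.2 (Real.exp_lt_exp.2 (by nlinarith))) hsr, ?_, ?_⟩
    · rintro t (ht | ht)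
      · rcases ht.eq_or_lt with rfl | ht
        · simp
        have := hconv.slope_mono_adjacent (mem_univ t) (mem_univ s) ht hlt
        rw [← hc, div_le_iff₀ (sub_pos.2 ht)] at this
        linarith
      · rcases ht.eq_or_lt with rfl | ht
        · linarith
        have := hconv.slope_mono_adjacent (mem_univ r) (mem_univ t) hlt ht
        rw [← hc, le_div_iff₀ (sub_pos.2 ht)] at this
        nlinarith
    · intro t h1 h2
      rcases h1.eq_or_lt with rfl | h1
      · simp
      rcases h2.eq_or_lt with rfl | h2
      · linarith
      have := hconv.secant_mono_aux1 (mem_univ r) (mem_univ s) h1 h2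
      refine le_of_mul_le_mul_left ?_ hsr
      nlinarith

end CompositeTest

/-! ### Two-sided sign patterns under exponential tilting. -/

namespace CompositeTest

section Tilting

variable {Y : Type*} [MeasurableSpace Y] {m : Measure Y} {T ψ : Y → ℝ}

lemma integrable_test_mul {w : Y → ℝ} (hψ : Measurable ψ) (hψ1 : ∀ y, |ψ y| ≤ 1)
    (hw : Integrable w m) : Integrable (fun y => ψ y * w y) m :=
  hw.bdd_mul (c := 1) hψ.aestronglyMeasurable (ae_of_all _ hψ1)

lemma integrable_mul_exp {K : ℝ} (hE : ∀ θ ∈ Icc (-K) K, Integrable (fun y => Real.exp (θ * T y)) m)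
    {θ : ℝ} (hθ : θ ∈ Ioo (-K) K) : Integrable (fun y => T y * Real.exp (θ * T y)) m := by
  have hint : θ ∈ interior (ProbabilityTheory.integrableExpSet T m) :=
    interior_mono (fun x hx => hE x hx) (by rwa [interior_Icc])
  simpa using ProbabilityTheory.integrable_pow_mul_exp_of_mem_interior_integrableExpSet hint 1

lemma integrable_sub_mul_exp {K : ℝ}
    (hE : ∀ θ ∈ Icc (-K) K, Integrable (fun y => Real.exp (θ * T y)) m)
    {θ : ℝ} (hθ : θ ∈ Ioo (-K) K) (r : ℝ) :
    Integrable (fun y => (T y - r) * Real.exp (θ * T y)) m := by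
  simp_rw [sub_mul]
  exact (integrable_mul_exp hE hθ).sub ((hE θ (Ioo_subset_Icc_self hθ)).const_mul r)

/-- The density ratio `exp ((θ - θ₀) T)` is compared with an affine function of `T`, on the side
dictated by the sign of `ψ`; multiplying by `exp (θ₀ T)` and integrating gives the bound. -/
lemma integral_exp_ge_of_pointwise {θ θ₀ c₁ c₂ r : ℝ}
    (i₀ : Integrable (fun y => ψ y * Real.exp (θ₀ * T y)) m)
    (i₁ : Integrable (fun y => ψ y * ((T y - r) * Real.exp (θ₀ * T y))) m)
    (i : Integrable (fun y => ψ y * Real.exp (θ * T y)) m)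
    (hpt : ∀ y, 0 ≤ ψ y * (Real.exp ((θ - θ₀) * T y) - c₁ - c₂ * (T y - r))) :
    c₁ * ∫ y, ψ y * Real.exp (θ₀ * T y) ∂m +
      c₂ * ∫ y, ψ y * ((T y - r) * Real.exp (θ₀ * T y)) ∂m ≤
      ∫ y, ψ y * Real.exp (θ * T y) ∂m := by
  rw [← integral_const_mul, ← integral_const_mul, ← integral_add (i₀.const_mul _) (i₁.const_mul _)]
  refine integral_mono ((i₀.const_mul _).add (i₁.const_mul _)) i fun y => ?_
  have h1 := mul_nonneg (hpt y) (Real.exp_pos (θ₀ * T y)).le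
  have h2 : Real.exp (θ * T y) = Real.exp ((θ - θ₀) * T y) * Real.exp (θ₀ * T y) := by
    rw [← Real.exp_add]; ring_nf
  rw [h2]
  nlinarith

/-- A test difference of constant sign relative to a level of `T`, with vanishing mass and vanishing
`X`-moment, is negligible for the whole exponential family. -/
lemma integral_exp_eq_zero_of_oneSided {X : ℝ → ℝ} (hX : StrictMono X) {a r : ℝ}
    (i₀ : Integrable (fun y => ψ y * Real.exp (a * T y)) m)
    (iX : Integrable (fun y => ψ y * (X (T y) * Real.exp (a * T y))) m)
    (h₀ : ∫ y, ψ y * Real.exp (a * T y) ∂m = 0)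
    (hXz : ∫ y, ψ y * (X (T y) * Real.exp (a * T y)) ∂m = 0)
    (hpt : ∀ y, 0 ≤ ψ y * (T y - r)) (θ : ℝ) :
    ∫ y, ψ y * Real.exp (θ * T y) ∂m = 0 := by
  have hnn : ∀ y, 0 ≤ ψ y * (X (T y) - X r) := by
    intro y
    rcases lt_trichotomy (T y) r with h | h | h
    · have : ψ y ≤ 0 := by nlinarith [hpt y]
      exact mul_nonneg_of_nonpos_of_nonpos this (sub_nonpos.2 (hX h).le)
    · simp [h]
    · have : 0 ≤ ψ y := by nlinarith [hpt y]
      exact mul_nonneg this (sub_nonneg.2 (hX h).le)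
  have hexp : ∀ y, ψ y * (X (T y) - X r) * Real.exp (a * T y) =
      ψ y * (X (T y) * Real.exp (a * T y)) - X r * (ψ y * Real.exp (a * T y)) :=
    fun y => by ring
  have hz : ∫ y, ψ y * (X (T y) - X r) * Real.exp (a * T y) ∂m = 0 := by
    simp_rw [hexp]
    rw [integral_sub iX (i₀.const_mul _), integral_const_mul, h₀, hXz]; simp
  rw [integral_eq_zero_iff_of_nonneg (fun y => mul_nonneg (hnn y) (Real.exp_pos _).le)
    (by simp_rw [hexp]; exact iX.sub (i₀.const_mul _))] at hz
  -- `ψ` is now carried by `{T = r}`, where all tilts are proportional.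
  have hae : (fun y => ψ y * Real.exp (θ * T y)) =ᵐ[m]
      fun y => Real.exp ((θ - a) * r) * (ψ y * Real.exp (a * T y)) := by
    filter_upwards [hz] with y hy
    simp only [Pi.zero_apply, mul_eq_zero, (Real.exp_pos _).ne', or_false, sub_eq_zero] at hy
    rcases hy with hy | hy
    · simp [hy]
    · rw [hX.injective hy, mul_left_comm, ← Real.exp_add]; ring_nf
  rw [integral_congr_ae hae, integral_const_mul, h₀, mul_zero]

lemma integral_exp_eq_zero_of_nonneg {a : ℝ}
    (i₀ : Integrable (fun y => ψ y * Real.exp (a * T y)) m)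
    (h₀ : ∫ y, ψ y * Real.exp (a * T y) ∂m = 0) (hpt : ∀ y, 0 ≤ ψ y) (θ : ℝ) :
    ∫ y, ψ y * Real.exp (θ * T y) ∂m = 0 := by
  rw [integral_eq_zero_iff_of_nonneg (fun y => mul_nonneg (hpt y) (Real.exp_pos _).le) i₀] at h₀
  refine integral_eq_zero_of_ae ?_
  filter_upwards [h₀] with y hy
  simp only [Pi.zero_apply, mul_eq_zero, (Real.exp_pos _).ne', or_false] at hy
  simp [hy]

/-- Chord comparison for a two-sided sign pattern. -/
lemma exists_chord_integral_le {K : ℝ}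
    (hE : ∀ θ ∈ Icc (-K) K, Integrable (fun y => Real.exp (θ * T y)) m)
    (hψ : Measurable ψ) (hψ1 : ∀ y, |ψ y| ≤ 1) {r s : ℝ} (hrs : r ≤ s)
    (hout : ∀ y, T y < r ∨ s < T y → 0 ≤ ψ y) (hin : ∀ y, r < T y → T y < s → ψ y ≤ 0)
    {θ₀ θ : ℝ} (hθ₀ : θ₀ ∈ Ioo (-K) K) (hθ : θ ∈ Icc (-K) K) :
    ∃ c : ℝ, (θ₀ < θ → 0 < c) ∧ (θ < θ₀ → c < 0) ∧
      Real.exp ((θ - θ₀) * r) * ∫ y, ψ y * Real.exp (θ₀ * T y) ∂m +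
        c * ∫ y, ψ y * ((T y - r) * Real.exp (θ₀ * T y)) ∂m ≤
        ∫ y, ψ y * Real.exp (θ * T y) ∂m := by
  obtain ⟨c, hc1, hc2, hco, hci⟩ := exists_exp_chord (θ - θ₀) hrs
  refine ⟨c, fun h => hc1 (sub_pos.2 h), fun h => hc2 (sub_neg.2 h), ?_⟩
  refine integral_exp_ge_of_pointwise
    (integrable_test_mul hψ hψ1 (hE _ (Ioo_subset_Icc_self hθ₀)))
    (integrable_test_mul hψ hψ1 (integrable_sub_mul_exp hE hθ₀ r))
    (integrable_test_mul hψ hψ1 (hE _ hθ)) fun y => ?_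
  rcases lt_trichotomy (T y) r with h | h | h
  · exact mul_nonneg (hout y (.inl h)) (hco _ (.inl h.le))
  · simp [h]
  rcases lt_trichotomy (T y) s with h' | h' | h'
  · exact mul_nonneg_of_nonpos_of_nonpos (hin y h h') (hci _ h.le h'.le)
  · have h3 := le_antisymm (hci (T y) h.le h'.le) (hco (T y) (.inr h'.ge))
    rw [h3, mul_zero]
  · exact mul_nonneg (hout y (.inr h')) (hco _ (.inr h'.le))

/-- If a two-sided sign pattern has positive integral at an interior parameter, then it has positive
integral at one of the endpoints. -/
theorem IsTwoSidedSign.integral_pos_endpoint {ℓ u : EReal} (h : IsTwoSidedSign T ψ ℓ u) {K : ℝ}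
    (hE : ∀ θ ∈ Icc (-K) K, Integrable (fun y => Real.exp (θ * T y)) m)
    (hψ : Measurable ψ) (hψ1 : ∀ y, |ψ y| ≤ 1) {a b θ₀ : ℝ} (ha : a ∈ Icc (-K) K)
    (hb : b ∈ Icc (-K) K) (hθ₀ : θ₀ ∈ Ioo a b)
    (hpos : 0 < ∫ y, ψ y * Real.exp (θ₀ * T y) ∂m) :
    0 < ∫ y, ψ y * Real.exp (a * T y) ∂m ∨ 0 < ∫ y, ψ y * Real.exp (b * T y) ∂m := by
  have hθK : θ₀ ∈ Ioo (-K) K := ⟨ha.1.trans_lt hθ₀.1, hθ₀.2.trans_le hb.2⟩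
  have i₀ := integrable_test_mul hψ hψ1 (hE _ (Ioo_subset_Icc_self hθK))
  have ia := integrable_test_mul hψ hψ1 (hE _ ha)
  have ib := integrable_test_mul hψ hψ1 (hE _ hb)
  rcases h.cases with ⟨r, s, hrs, hout, hin⟩ | ⟨r, hr⟩ | ⟨r, hr⟩ | hnn | hnp
  -- The slope `c` is positive towards `b` and negative towards `a`, so the sign of the moment about
  -- `r` selects the endpoint at which the slope term is nonnegative.
  · rcases le_total 0 (∫ y, ψ y * ((T y - r) * Real.exp (θ₀ * T y)) ∂m) with hJ | hJ
    · obtain ⟨c, hc, -, hle⟩ := exists_chord_integral_le hE hψ hψ1 hrs hout hin hθK hb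
      exact .inr (lt_of_lt_of_le (add_pos_of_pos_of_nonneg (mul_pos (Real.exp_pos _) hpos)
        (mul_nonneg (hc hθ₀.2).le hJ)) hle)
    · obtain ⟨c, -, hc, hle⟩ := exists_chord_integral_le hE hψ hψ1 hrs hout hin hθK ha
      exact .inl (lt_of_lt_of_le (add_pos_of_pos_of_nonneg (mul_pos (Real.exp_pos _) hpos)
        (mul_nonneg_of_nonpos_of_nonpos (hc hθ₀.1).le hJ)) hle)
  -- With a single sign change at `r` a constant replaces the chord: `exp ((b - θ₀) T)` crosses its
  -- value at `r` with the same signs as `ψ`.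
  · refine .inr (lt_of_lt_of_le (mul_pos (Real.exp_pos ((b - θ₀) * r)) hpos) ?_)
    have := integral_exp_ge_of_pointwise (r := r) (c₁ := Real.exp ((b - θ₀) * r)) (c₂ := 0) i₀
      (integrable_test_mul hψ hψ1 (integrable_sub_mul_exp hE hθK r)) ib fun y => ?_
    · simpa using this
    have hκ : 0 < b - θ₀ := sub_pos.2 hθ₀.2
    rcases lt_trichotomy (T y) r with h | h | h
    · refine mul_nonneg_of_nonpos_of_nonpos (by nlinarith [hr y]) ?_
      have := Real.exp_le_exp.2 (mul_le_mul_of_nonneg_left h.le hκ.le)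
      linarith
    · simp [h]
    · refine mul_nonneg (by nlinarith [hr y]) ?_
      have := Real.exp_le_exp.2 (mul_le_mul_of_nonneg_left h.le hκ.le)
      linarith
  · refine .inl (lt_of_lt_of_le (mul_pos (Real.exp_pos ((a - θ₀) * r)) hpos) ?_)
    have := integral_exp_ge_of_pointwise (r := r) (c₁ := Real.exp ((a - θ₀) * r)) (c₂ := 0) i₀
      (integrable_test_mul hψ hψ1 (integrable_sub_mul_exp hE hθK r)) ia fun y => ?_
    · simpa using this
    have hκ : a - θ₀ < 0 := sub_neg.2 hθ₀.1
    rcases lt_trichotomy (T y) r with h | h | h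
    · refine mul_nonneg (by nlinarith [hr y]) ?_
      have := Real.exp_le_exp.2 (mul_le_mul_of_nonpos_left h.le hκ.le)
      linarith
    · simp [h]
    · refine mul_nonneg_of_nonpos_of_nonpos (by nlinarith [hr y]) ?_
      have := Real.exp_le_exp.2 (mul_le_mul_of_nonpos_left h.le hκ.le)
      linarith
  · refine .inl (lt_of_le_of_ne
      (integral_nonneg fun y => mul_nonneg (hnn y) (Real.exp_pos _).le) fun h0 => ?_)
    rw [integral_exp_eq_zero_of_nonneg ia h0.symm hnn θ₀] at hpos
    exact lt_irrefl _ hpos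
  · exact absurd hpos (not_lt.2 (integral_nonpos fun y =>
      mul_nonpos_of_nonpos_of_nonneg (hnp y) (Real.exp_pos _).le))

/-- The statistic whose expectation under the tilt at `a` is matched, besides the size at `a`: it
encodes the power at `b` if `a < b`, and the derivative of the power if `a = b`. -/
noncomputable def matchedMoment (a b t : ℝ) : ℝ := if a < b then Real.exp ((b - a) * t) else t

lemma strictMono_matchedMoment (a b : ℝ) : StrictMono (matchedMoment a b) := by
  intro x y hxy
  unfold matchedMoment
  split_ifs with h
  · exact Real.exp_lt_exp.2 (mul_lt_mul_of_pos_left hxy (sub_pos.2 h))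
  · exact hxy

lemma matchedMoment_mul_exp {a b : ℝ} (h : a < b) (t : ℝ) :
    matchedMoment a b t * Real.exp (a * t) = Real.exp (b * t) := by
  rw [matchedMoment, if_pos h, ← Real.exp_add]; ring_nf

lemma integrable_matchedMoment {K : ℝ}
    (hE : ∀ θ ∈ Icc (-K) K, Integrable (fun y => Real.exp (θ * T y)) m) {a b : ℝ}
    (ha : a ∈ Ioo (-K) K) (hb : b ∈ Ioo (-K) K) :
    Integrable (fun y => matchedMoment a b (T y) * Real.exp (a * T y)) m := by
  by_cases h : a < b
  · simp_rw [matchedMoment_mul_exp h]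
    exact hE _ (Ioo_subset_Icc_self hb)
  · simp_rw [matchedMoment, if_neg h]
    exact integrable_mul_exp hE ha

/-- A two-sided sign pattern with vanishing size and matched moment has nonnegative integral at
every parameter outside `[a, b]`. -/
theorem IsTwoSidedSign.integral_nonneg_outside {ℓ u : EReal} (h : IsTwoSidedSign T ψ ℓ u) {K : ℝ}
    (hE : ∀ θ ∈ Icc (-K) K, Integrable (fun y => Real.exp (θ * T y)) m)
    (hψ : Measurable ψ) (hψ1 : ∀ y, |ψ y| ≤ 1) {a b : ℝ} (hab : a ≤ b) (ha : a ∈ Ioo (-K) K)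
    (hb : b ∈ Ioo (-K) K) (h₀ : ∫ y, ψ y * Real.exp (a * T y) ∂m = 0)
    (hX : ∫ y, ψ y * (matchedMoment a b (T y) * Real.exp (a * T y)) ∂m = 0)
    {θ : ℝ} (hθ : θ ∈ Icc (-K) K) (hθab : θ ∉ Icc a b) :
    0 ≤ ∫ y, ψ y * Real.exp (θ * T y) ∂m := by
  have ia := integrable_test_mul hψ hψ1 (hE _ (Ioo_subset_Icc_self ha))
  have iX := integrable_test_mul hψ hψ1 (integrable_matchedMoment hE ha hb)
  have hXm := strictMono_matchedMoment a b
  rcases h.cases with ⟨r, s, hrs, hout, hin⟩ | ⟨r, hr⟩ | ⟨r, hr⟩ | hnn | hnp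
  · rcases hab.eq_or_lt with rfl | hlt
    -- For `a = b` both terms of the chord bound based at `a` vanish.
    · have hJ : ∫ y, ψ y * ((T y - r) * Real.exp (a * T y)) ∂m = 0 := by
        simp only [matchedMoment, lt_irrefl, if_false] at hX iX
        have hexp : ∀ y, ψ y * ((T y - r) * Real.exp (a * T y)) =
            ψ y * (T y * Real.exp (a * T y)) - r * (ψ y * Real.exp (a * T y)) :=
          fun y => by ring
        simp_rw [hexp]
        rw [integral_sub iX (ia.const_mul r), integral_const_mul, hX, h₀]; simp
      obtain ⟨c, -, -, hle⟩ := exists_chord_integral_le hE hψ hψ1 hrs hout hin ha hθ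
      rwa [h₀, hJ, mul_zero, mul_zero, add_zero] at hle
    · simp_rw [matchedMoment_mul_exp hlt] at hX
      -- For `θ < a`, the chord bound from `a` to `b`, where both integrals of `ψ` vanish, forces
      -- the moment at `a` to be nonpositive; towards `θ` the slope is negative, so the bound
      -- becomes nonnegative. For `θ > b` the roles of `a` and `b` are exchanged.
      rcases lt_or_ge θ a with hθa | hθa
      · obtain ⟨c, hc, -, hle⟩ := exists_chord_integral_le hE hψ hψ1 hrs hout hin ha
          (Ioo_subset_Icc_self hb)
        obtain ⟨c', -, hc', hle'⟩ := exists_chord_integral_le hE hψ hψ1 hrs hout hin ha hθ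
        rw [h₀, mul_zero, zero_add] at hle hle'
        rw [hX] at hle
        have hJ := nonpos_of_mul_nonpos_right hle (hc hlt)
        exact (mul_nonneg_of_nonpos_of_nonpos (hc' hθa).le hJ).trans hle'
      · have hθb : b < θ := by
          by_contra hcon
          exact hθab ⟨hθa, not_lt.1 hcon⟩
        obtain ⟨c, -, hc, hle⟩ := exists_chord_integral_le hE hψ hψ1 hrs hout hin hb
          (Ioo_subset_Icc_self ha)
        obtain ⟨c', hc', -, hle'⟩ := exists_chord_integral_le hE hψ hψ1 hrs hout hin hb hθ
        rw [hX, mul_zero, zero_add] at hle hle'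
        rw [h₀] at hle
        have hJ := nonneg_of_mul_nonpos_right hle (hc hlt)
        exact (mul_nonneg (hc' hθb).le hJ).trans hle'
  · exact (integral_exp_eq_zero_of_oneSided hXm ia iX h₀ hX hr θ).ge
  · have := integral_exp_eq_zero_of_oneSided (ψ := fun y => -ψ y) (r := r) hXm
      (by simp_rw [neg_mul]; exact ia.neg) (by simp_rw [neg_mul]; exact iX.neg)
      (by simp only [neg_mul, integral_neg, h₀, neg_zero])
      (by simp only [neg_mul, integral_neg, hX, neg_zero])
      (fun y => by rw [neg_mul]; exact neg_nonneg.2 (hr y)) θ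
    simp only [neg_mul, integral_neg, neg_eq_zero] at this
    exact this.ge
  · exact (integral_exp_eq_zero_of_nonneg ia h₀ hnn θ).ge
  · have := integral_exp_eq_zero_of_nonneg (ψ := fun y => -ψ y)
      (by simp_rw [neg_mul]; exact ia.neg)
      (by simp only [neg_mul, integral_neg, h₀, neg_zero]) (fun y => neg_nonneg.2 (hnp y)) θ
    simp only [neg_mul, integral_neg, neg_eq_zero] at this
    exact this.ge

end Tilting

end CompositeTest

/-! ### Power functions: complete class and quasi-convexity. -/

namespace CompositeTest

/-- The power of `δ` at `θ` in the exponential family generated by `m` and `T`. -/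
noncomputable def tiltedPower {Y : Type*} [MeasurableSpace Y] (m : Measure Y) (T δ : Y → ℝ)
    (θ : ℝ) : ℝ :=
  (∫ y, Real.exp (θ * T y) ∂m)⁻¹ * ∫ y, δ y * Real.exp (θ * T y) ∂m

section TiltedPower

variable {Y : Type*} [MeasurableSpace Y] {m : Measure Y} {T δ : Y → ℝ} {K : ℝ}

lemma integral_tilted_mul (a : ℝ) (g : Y → ℝ) :
    ∫ y, g y ∂(m.tilted fun y => a * T y) =
      (∫ y, Real.exp (a * T y) ∂m)⁻¹ * ∫ y, g y * Real.exp (a * T y) ∂m := by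
  rw [integral_tilted, ← integral_const_mul]
  refine integral_congr_ae (ae_of_all _ fun y => ?_)
  simp only [smul_eq_mul]; ring

lemma tiltedPower_nonneg (hδ : IsDecisionRule δ) (θ : ℝ) : 0 ≤ tiltedPower m T δ θ :=
  mul_nonneg (inv_nonneg.2 (integral_nonneg fun _ => (Real.exp_pos _).le))
    (integral_nonneg fun y => mul_nonneg (hδ.2 y).1 (Real.exp_pos _).le)

lemma tiltedPower_convex_one [NeZero m] (hδ : IsDecisionRule δ) {θ : ℝ}
    (hE : Integrable (fun y => Real.exp (θ * T y)) m) (ε : ℝ) :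
    tiltedPower m T (fun y => δ y + ε * (1 - δ y)) θ =
      tiltedPower m T δ θ + ε * (1 - tiltedPower m T δ θ) := by
  have hpos := integral_exp_pos hE
  have h1 := hδ.integrable_mul hE
  have hexp : ∀ y, (δ y + ε * (1 - δ y)) * Real.exp (θ * T y) =
      δ y * Real.exp (θ * T y) + ε * (Real.exp (θ * T y) - δ y * Real.exp (θ * T y)) :=
    fun y => by ring
  unfold tiltedPower
  simp_rw [hexp]
  rw [integral_add (g := fun y => ε * (Real.exp (θ * T y) - δ y * Real.exp (θ * T y)))
    h1 ((hE.sub h1).const_mul ε), integral_const_mul, integral_sub hE h1]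
  field_simp

lemma tiltedPower_one_sub [NeZero m] (hδ : IsDecisionRule δ) {θ : ℝ}
    (hE : Integrable (fun y => Real.exp (θ * T y)) m) :
    tiltedPower m T (fun y => 1 - δ y) θ = 1 - tiltedPower m T δ θ := by
  have hpos := integral_exp_pos hE
  unfold tiltedPower
  simp_rw [sub_mul, one_mul]
  rw [integral_sub hE (hδ.integrable_mul hE)]
  field_simp

lemma tiltedPower_mem_Icc [NeZero m] (hδ : IsDecisionRule δ) {θ : ℝ}
    (hE : Integrable (fun y => Real.exp (θ * T y)) m) :
    tiltedPower m T δ θ ∈ Icc (0 : ℝ) 1 := by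
  refine ⟨tiltedPower_nonneg hδ θ, ?_⟩
  have := tiltedPower_nonneg (m := m) (T := T) hδ.one_sub θ
  rw [tiltedPower_one_sub hδ hE] at this
  linarith

/-- All tilts share the null sets of `m`: power `1` at one parameter means `δ = 1` almost
everywhere, hence power `1` at every other. -/
lemma tiltedPower_lt_one [NeZero m] (hδ : IsDecisionRule δ) {θ θ' : ℝ}
    (hE : Integrable (fun y => Real.exp (θ * T y)) m)
    (hE' : Integrable (fun y => Real.exp (θ' * T y)) m) (h : tiltedPower m T δ θ' < 1) :
    tiltedPower m T δ θ < 1 := by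
  refine lt_of_le_of_ne (tiltedPower_mem_Icc hδ hE).2 fun h1 => ?_
  have h2 := tiltedPower_one_sub hδ hE
  rw [h1, sub_self, tiltedPower, mul_eq_zero] at h2
  have h3 := h2.resolve_left (inv_ne_zero (integral_exp_pos hE).ne')
  have h4 := integral_exp_eq_zero_of_nonneg (hδ.one_sub.integrable_mul hE) h3
    (fun y => (hδ.one_sub.2 y).1) θ'
  have h5 := tiltedPower_one_sub hδ hE'
  rw [tiltedPower, h4, mul_zero] at h5
  linarith

lemma continuousOn_integral_mul_exp
    (hE : ∀ θ ∈ Icc (-K) K, Integrable (fun y => Real.exp (θ * T y)) m) (hK : 0 ≤ K)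
    (hT : Measurable T) (hδ : IsDecisionRule δ) :
    ContinuousOn (fun θ => ∫ y, δ y * Real.exp (θ * T y) ∂m) (Icc (-K) K) := by
  refine continuousOn_of_dominated
    (bound := fun y => Real.exp (K * T y) + Real.exp (-K * T y))
    (fun θ _ => (hδ.1.mul (by fun_prop)).aestronglyMeasurable) ?_
    ((hE K ⟨by linarith, le_rfl⟩).add (hE (-K) ⟨le_rfl, by linarith⟩)) ?_
  · refine fun θ hθ => ae_of_all _ fun y => ?_
    rw [Real.norm_eq_abs, abs_mul, abs_of_nonneg (hδ.2 y).1, abs_of_pos (Real.exp_pos _)]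
    refine (mul_le_of_le_one_left (Real.exp_pos _).le (hδ.2 y).2).trans ?_
    rcases le_total 0 (T y) with h | h
    · have := Real.exp_le_exp.2 (mul_le_mul_of_nonneg_right hθ.2 h)
      linarith [Real.exp_pos (-K * T y)]
    · have := Real.exp_le_exp.2 (mul_le_mul_of_nonpos_right hθ.1 h)
      linarith [Real.exp_pos (K * T y)]
  · exact ae_of_all _ fun y => by fun_prop

lemma continuousOn_tiltedPower [NeZero m]
    (hE : ∀ θ ∈ Icc (-K) K, Integrable (fun y => Real.exp (θ * T y)) m) (hK : 0 ≤ K)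
    (hT : Measurable T) (hδ : IsDecisionRule δ) :
    ContinuousOn (tiltedPower m T δ) (Icc (-K) K) := by
  have h1 := continuousOn_integral_mul_exp hE hK hT (δ := fun _ => 1)
    ⟨measurable_const, fun _ => by simp⟩
  simp only [one_mul] at h1
  exact (h1.inv₀ fun θ hθ => (integral_exp_pos (hE θ hθ)).ne').mul
    (continuousOn_integral_mul_exp hE hK hT hδ)

variable {U : ℝ → ℝ → ℝ} {a b : ℝ}

/-- The chain is calibrated at `a`; power at `θ` brings in the possibly unbounded weight `exp ((θ -
a) T)`, hence continuity for merely integrable weights is needed. -/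
lemma continuousOn_tiltedPower_twoSided [NeZero m]
    (hE : ∀ θ ∈ Icc (-K) K, Integrable (fun y => Real.exp (θ * T y)) m)
    (hT : Measurable T) (ha : a ∈ Icc (-K) K)
    (hU : IsStepFamily (m.tilted fun y => a * T y) T U) {θ : ℝ} (hθ : θ ∈ Icc (-K) K) :
    ContinuousOn (fun q : ℝ × ℝ => tiltedPower m T (twoSided T U q.1 q.2) θ) sizePairs := by
  have := isProbabilityMeasure_tilted (hE a ha)
  have hsplit : ∀ y, Real.exp (θ * T y) = Real.exp ((θ - a) * T y) * Real.exp (a * T y) :=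
    fun y => by rw [← Real.exp_add]; ring_nf
  have hw : Integrable (fun y => Real.exp ((θ - a) * T y)) (m.tilted fun y => a * T y) := by
    rw [integrable_tilted_iff (hE a ha)]
    refine (hE θ hθ).congr (ae_of_all _ fun y => ?_)
    simp only [smul_eq_mul]
    rw [hsplit, mul_comm]
  have hc := hU.continuousOn_twoSided hT hw
  simp_rw [integral_tilted_mul, mul_assoc, ← hsplit] at hc
  have hpos := integral_exp_pos (hE a ha)
  have h2 := (hc.const_smul (∫ y, Real.exp (a * T y) ∂m)).const_smul
    (∫ y, Real.exp (θ * T y) ∂m)⁻¹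
  refine h2.congr fun q _ => ?_
  simp only [tiltedPower, smul_eq_mul, Pi.smul_apply]
  rw [mul_inv_cancel_left₀ hpos.ne']

/-- Off its thresholds `δ` takes the extreme values `1` and `0`, which fixes the sign of its
difference with any rule. -/
lemma isTwoSidedSign_sub {φ : Y → ℝ} (hφ : IsDecisionRule φ) {ℓ u : EReal} (hle : ℓ ≤ u)
    (h1 : ∀ y, (T y : EReal) < ℓ ∨ u < (T y : EReal) → δ y = 1)
    (h0 : ∀ y, ℓ < (T y : EReal) → (T y : EReal) < u → δ y = 0) :
    IsTwoSidedSign T (fun y => δ y - φ y) ℓ u :=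
  ⟨hle, fun y hy => by simp only [h1 y hy]; exact sub_nonneg.2 (hφ.2 y).2,
    fun y hl hu => by simp only [h0 y hl hu]; linarith [(hφ.2 y).1]⟩

lemma IsDecisionRule.abs_sub_le_one {φ : Y → ℝ} (hδ : IsDecisionRule δ) (hφ : IsDecisionRule φ)
    (y : Y) : |δ y - φ y| ≤ 1 := by
  rw [abs_le]
  exact ⟨by linarith [(hδ.2 y).1, (hφ.2 y).2], by linarith [(hδ.2 y).2, (hφ.2 y).1]⟩

/-- Two-sided tests form an essentially complete class: every test is dominated by a two-sided
test that has the same power at `a` and `b` and at least the same power outside `[a, b]`. -/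
theorem exists_twoSided_dominating [NeZero m]
    (hE : ∀ θ ∈ Icc (-K) K, Integrable (fun y => Real.exp (θ * T y)) m)
    (hT : Measurable T) (hab : a ≤ b) (ha : a ∈ Ioo (-K) K) (hb : b ∈ Ioo (-K) K)
    (hU : IsStepFamily (m.tilted fun y => a * T y) T U) {φ : Y → ℝ} (hφ : IsDecisionRule φ) :
    ∃ q ∈ sizePairs, tiltedPower m T (twoSided T U q.1 q.2) a = tiltedPower m T φ a ∧
      tiltedPower m T (twoSided T U q.1 q.2) b = tiltedPower m T φ b ∧
      ∀ θ ∈ Icc (-K) K, θ ∉ Icc a b →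
        tiltedPower m T φ θ ≤ tiltedPower m T (twoSided T U q.1 q.2) θ := by
  have hEa := hE a (Ioo_subset_Icc_self ha)
  have hEb := hE b (Ioo_subset_Icc_self hb)
  have := isProbabilityMeasure_tilted hEa
  have hXE := integrable_matchedMoment hE ha hb
  have hXi : Integrable (fun y => matchedMoment a b (T y)) (m.tilted fun y => a * T y) := by
    rw [integrable_tilted_iff hEa]
    refine hXE.congr (ae_of_all _ fun y => ?_)
    simp only [smul_eq_mul]; rw [mul_comm]
  obtain ⟨q, hq, h1, h2⟩ := hU.exists_twoSided_matching hT
    (strictMono_matchedMoment a b).monotone hXi hφ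
  have hδ := hU.isDecisionRule_twoSided hT hq
  set δ := twoSided T U q.1 q.2 with hδdef
  have hc : (∫ y, Real.exp (a * T y) ∂m)⁻¹ ≠ 0 := inv_ne_zero (integral_exp_pos hEa).ne'
  rw [integral_tilted_mul, integral_tilted_mul] at h1 h2
  simp_rw [mul_assoc] at h2
  have h1' := mul_left_cancel₀ hc h1
  have h2' := mul_left_cancel₀ hc h2
  have hz1 : ∫ y, (δ y - φ y) * Real.exp (a * T y) ∂m = 0 := by
    simp_rw [sub_mul]
    rw [integral_sub (hδ.integrable_mul hEa) (hφ.integrable_mul hEa), h1', sub_self]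
  have hz2 : ∫ y, (δ y - φ y) * (matchedMoment a b (T y) * Real.exp (a * T y)) ∂m = 0 := by
    simp_rw [sub_mul]
    rw [integral_sub (hδ.integrable_mul hXE) (hφ.integrable_mul hXE), h2', sub_self]
  obtain ⟨ℓ, u, hle, ho, hi⟩ := hU.exists_thresholds hq
  refine ⟨q, hq, h1, ?_, fun θ hθ hθab => ?_⟩
  · rcases hab.eq_or_lt with rfl | hlt
    · exact h1
    · simp_rw [matchedMoment_mul_exp hlt] at h2'
      rw [tiltedPower, tiltedPower, h2']
  · have hnn := (isTwoSidedSign_sub hφ hle ho hi).integral_nonneg_outside hE (hδ.1.sub hφ.1)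
      (hδ.abs_sub_le_one hφ) hab ha hb hz1 hz2 hθ hθab
    simp_rw [sub_mul] at hnn
    rw [integral_sub (hδ.integrable_mul (hE θ hθ)) (hφ.integrable_mul (hE θ hθ))] at hnn
    exact mul_le_mul_of_nonneg_left (sub_nonneg.1 hnn)
      (inv_nonneg.2 (integral_exp_pos (hE θ hθ)).le)

/-- The power function of a two-sided test is quasi-convex. -/
theorem tiltedPower_le_max_endpoints [NeZero m]
    (hE : ∀ θ ∈ Icc (-K) K, Integrable (fun y => Real.exp (θ * T y)) m)
    (ha : a ∈ Icc (-K) K) (hb : b ∈ Icc (-K) K) (hδ : IsDecisionRule δ)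
    {ℓ u : EReal} (hle : ℓ ≤ u)
    (h1 : ∀ y, (T y : EReal) < ℓ ∨ u < (T y : EReal) → δ y = 1)
    (h0 : ∀ y, ℓ < (T y : EReal) → (T y : EReal) < u → δ y = 0)
    {θ : ℝ} (hθ : θ ∈ Icc a b) :
    tiltedPower m T δ θ ≤ max (tiltedPower m T δ a) (tiltedPower m T δ b) := by
  rcases hθ.1.eq_or_lt with rfl | hθa
  · exact le_max_left _ _
  rcases hθ.2.eq_or_lt with rfl | hθb
  · exact le_max_right _ _
  set M := max (tiltedPower m T δ a) (tiltedPower m T δ b) with hM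
  -- The constant rule `M` has power `M` at every parameter, so an excess of `δ` over it inside `(a,
  -- b)` would carry over to an endpoint.
  have hMr : IsDecisionRule fun _ : Y => M :=
    ⟨measurable_const, fun _ => ⟨le_max_of_le_left (tiltedPower_nonneg hδ a),
      max_le (tiltedPower_mem_Icc hδ (hE a ha)).2 (tiltedPower_mem_Icc hδ (hE b hb)).2⟩⟩
  have key : ∀ x ∈ Icc (-K) K, ∫ y, (δ y - M) * Real.exp (x * T y) ∂m =
      (∫ y, Real.exp (x * T y) ∂m) * (tiltedPower m T δ x - M) := by
    intro x hx
    have hpos := integral_exp_pos (hE x hx)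
    simp_rw [sub_mul]
    rw [integral_sub (hδ.integrable_mul (hE x hx)) ((hE x hx).const_mul M), integral_const_mul,
      tiltedPower]
    field_simp
  have hθK : θ ∈ Icc (-K) K := ⟨ha.1.trans hθ.1, hθ.2.trans hb.2⟩
  by_contra hcon
  have hpos : 0 < ∫ y, (δ y - M) * Real.exp (θ * T y) ∂m := by
    rw [key θ hθK]
    exact mul_pos (integral_exp_pos (hE θ hθK)) (sub_pos.2 (not_le.1 hcon))
  rcases (isTwoSidedSign_sub hMr hle h1 h0).integral_pos_endpoint hE (hδ.1.sub hMr.1)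
    (hδ.abs_sub_le_one hMr) ha hb ⟨hθa, hθb⟩ hpos with h | h
  · rw [key a ha] at h
    have := pos_of_mul_pos_right h (integral_exp_pos (hE a ha)).le
    linarith [le_max_left (tiltedPower m T δ a) (tiltedPower m T δ b)]
  · rw [key b hb] at h
    have := pos_of_mul_pos_right h (integral_exp_pos (hE b hb)).le
    linarith [le_max_right (tiltedPower m T δ a) (tiltedPower m T δ b)]

end TiltedPower

end CompositeTest

/-! ### The objective, and the passage to densities and interval rules. -/

namespace CompositeTest

section Objective

variable {g : ℝ → ℝ} {Λ : Measure ℝ} [IsFiniteMeasure Λ] {K : ℝ} {S : Set ℝ}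

lemma integrableOn_utility (hg : ContinuousOn g (Icc 0 1)) (hS : S ⊆ Icc (-K) K) {p : ℝ → ℝ}
    (hp : ContinuousOn p (Icc (-K) K)) (hp1 : ∀ θ ∈ Icc (-K) K, p θ ∈ Icc (0 : ℝ) 1) :
    IntegrableOn (fun θ => g (p θ)) S Λ :=
  ((hg.comp hp hp1).integrableOn_compact isCompact_Icc).mono_set hS

lemma setIntegral_utility_mono (hg : ContinuousOn g (Icc 0 1)) (hgm : StrictMonoOn g (Icc 0 1))
    (hSm : MeasurableSet S) (hS : S ⊆ Icc (-K) K) {p q : ℝ → ℝ}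
    (hp : ContinuousOn p (Icc (-K) K)) (hp1 : ∀ θ ∈ Icc (-K) K, p θ ∈ Icc (0 : ℝ) 1)
    (hq : ContinuousOn q (Icc (-K) K)) (hq1 : ∀ θ ∈ Icc (-K) K, q θ ∈ Icc (0 : ℝ) 1)
    (hpq : ∀ θ ∈ S, p θ ≤ q θ) :
    ∫ θ in S, g (p θ) ∂Λ ≤ ∫ θ in S, g (q θ) ∂Λ :=
  setIntegral_mono_on (integrableOn_utility hg hS hp hp1) (integrableOn_utility hg hS hq hq1) hSm
    fun θ hθ => hgm.monotoneOn (hp1 θ (hS hθ)) (hq1 θ (hS hθ)) (hpq θ hθ)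

lemma setIntegral_utility_lt (hg : ContinuousOn g (Icc 0 1)) (hgm : StrictMonoOn g (Icc 0 1))
    (hSm : MeasurableSet S) (hS : S ⊆ Icc (-K) K) (hΛ : Λ S ≠ 0) {p q : ℝ → ℝ}
    (hp : ContinuousOn p (Icc (-K) K)) (hp1 : ∀ θ ∈ Icc (-K) K, p θ ∈ Icc (0 : ℝ) 1)
    (hq : ContinuousOn q (Icc (-K) K)) (hq1 : ∀ θ ∈ Icc (-K) K, q θ ∈ Icc (0 : ℝ) 1)
    (hpq : ∀ θ ∈ S, p θ < q θ) :
    ∫ θ in S, g (p θ) ∂Λ < ∫ θ in S, g (q θ) ∂Λ := by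
  have hlt : ∀ θ ∈ S, 0 < g (q θ) - g (p θ) := fun θ hθ =>
    sub_pos.2 (hgm (hp1 θ (hS hθ)) (hq1 θ (hS hθ)) (hpq θ hθ))
  have ip := integrableOn_utility (Λ := Λ) hg hS hp hp1
  have iq := integrableOn_utility (Λ := Λ) hg hS hq hq1
  rw [← sub_pos, ← integral_sub iq ip, setIntegral_pos_iff_support_of_nonneg_ae
    (ae_restrict_of_forall_mem hSm fun θ hθ => (hlt θ hθ).le) (iq.sub ip)]
  refine lt_of_lt_of_le (pos_iff_ne_zero.2 hΛ) (measure_mono fun θ hθ => ⟨(hlt θ hθ).ne', hθ⟩)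

lemma continuousOn_setIntegral_utility (hg : ContinuousOn g (Icc 0 1))
    (hSm : MeasurableSet S) (hS : S ⊆ Icc (-K) K) {A : Set (ℝ × ℝ)} {P : ℝ × ℝ → ℝ → ℝ}
    (hP : ∀ q ∈ A, ContinuousOn (P q) (Icc (-K) K))
    (hP1 : ∀ q ∈ A, ∀ θ ∈ Icc (-K) K, P q θ ∈ Icc (0 : ℝ) 1)
    (hPq : ∀ θ ∈ Icc (-K) K, ContinuousOn (fun q => P q θ) A) :
    ContinuousOn (fun q => ∫ θ in S, g (P q θ) ∂Λ) A := by
  obtain ⟨C, hC⟩ := isCompact_Icc.exists_bound_of_continuousOn hg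
  refine continuousOn_of_dominated (bound := fun _ => C)
    (fun q hq => (integrableOn_utility hg hS (hP q hq) (hP1 q hq)).aestronglyMeasurable)
    (fun q hq => ae_restrict_of_forall_mem hSm fun θ hθ => hC _ (hP1 q hq θ (hS hθ)))
    (integrable_const _) (ae_restrict_of_forall_mem hSm fun θ hθ => ?_)
  exact hg.comp (hPq θ (hS hθ)) fun q hq => hP1 q hq θ (hS hθ)

end Objective

section ExponentialFamily

variable {Y : Type*} [MeasurableSpace Y] {μ : Measure Y} {h T : Y → ℝ}

/-- The carrier measure `h dμ`. -/
noncomputable def carrier (μ : Measure Y) (h : Y → ℝ) : Measure Y :=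
  μ.withDensity fun y => ENNReal.ofReal (h y)

lemma integral_carrier (hh : Measurable h) (hh0 : ∀ y, 0 ≤ h y) (φ : Y → ℝ) :
    ∫ y, φ y ∂(carrier μ h) = ∫ y, h y * φ y ∂μ := by
  rw [carrier, integral_withDensity_eq_integral_toReal_smul hh.ennreal_ofReal
    (ae_of_all _ fun _ => ENNReal.ofReal_lt_top)]
  simp only [smul_eq_mul, ENNReal.toReal_ofReal (hh0 _)]

lemma integrable_carrier_iff (hh : Measurable h) (hh0 : ∀ y, 0 ≤ h y) (φ : Y → ℝ) :
    Integrable φ (carrier μ h) ↔ Integrable (fun y => h y * φ y) μ := by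
  rw [carrier, integrable_withDensity_iff hh.ennreal_ofReal
    (ae_of_all _ fun _ => ENNReal.ofReal_lt_top)]
  simp only [ENNReal.toReal_ofReal (hh0 _), mul_comm]

lemma neZero_carrier (hh : Measurable h) (hh0 : ∀ y, 0 ≤ h y) (hne : ¬ ∀ᵐ y ∂μ, h y = 0) :
    NeZero (carrier μ h) := by
  refine ⟨fun h0 => hne ?_⟩
  rw [carrier, withDensity_eq_zero_iff hh.ennreal_ofReal.aemeasurable] at h0
  filter_upwards [h0] with y hy
  exact le_antisymm (ENNReal.ofReal_eq_zero.1 hy) (hh0 y)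

/-- The factor `h` is absorbed into the measure. No integrability is required, so the identity holds
for every `θ`. -/
lemma power_expDensity_eq (hh : Measurable h) (hh0 : ∀ y, 0 ≤ h y) (δ : Y → ℝ) :
    power μ (expDensity μ h T) δ = tiltedPower (carrier μ h) T δ := by
  funext θ
  rw [power, tiltedPower, integral_carrier hh hh0, integral_carrier hh hh0, ← integral_const_mul]
  refine integral_congr_ae (ae_of_all _ fun y => ?_)
  simp only [expDensity, expNorm]; ring

lemma power_expDensity_congr {δ δ' : Y → ℝ}
    (hδ : μ {y | 0 < h y ∧ δ y ≠ δ' y} = 0) (hh0 : ∀ y, 0 ≤ h y) :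
    power μ (expDensity μ h T) δ = power μ (expDensity μ h T) δ' := by
  funext θ
  refine integral_congr_ae ?_
  filter_upwards [compl_mem_ae_iff.2 hδ] with y hy
  simp only [mem_compl_iff, mem_ofPred_eq, not_and, not_not] at hy
  rcases (hh0 y).eq_or_lt with h0 | h0
  · simp [expDensity, ← h0]
  · rw [hy h0]

lemma isDecisionRule_intervalRule (hT : Measurable T) (ℓ u : EReal) {γ : Y → ℝ}
    (hγ : IsDecisionRule γ) : IsDecisionRule (intervalRule T ℓ u γ) := by
  have hTE : Measurable fun y => (T y : EReal) := hT.coe_real_ereal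
  refine ⟨?_, fun y => ?_⟩
  · unfold intervalRule
    refine Measurable.ite ?_ measurable_const (Measurable.ite ?_ hγ.1 measurable_const)
    · exact (measurableSet_lt measurable_const hTE).union (measurableSet_lt hTE measurable_const)
    · exact (measurableSet_eq_fun hTE measurable_const).union
        (measurableSet_eq_fun hTE measurable_const)
  · unfold intervalRule
    split_ifs
    · simp
    · exact hγ.2 y
    · simp

lemma intervalRule_self {Z : Type*} {T δ : Z → ℝ} {ℓ u : EReal}
    (h1 : ∀ y, (T y : EReal) < ℓ ∨ u < (T y : EReal) → δ y = 1)
    (h0 : ∀ y, ℓ < (T y : EReal) → (T y : EReal) < u → δ y = 0) :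
    δ = intervalRule T ℓ u δ := by
  funext y
  unfold intervalRule
  split_ifs with c1 c2
  · exact h1 y c1.symm
  · rfl
  · simp only [not_or, not_lt] at c1 c2
    exact h0 y (lt_of_le_of_ne c1.2 (Ne.symm c2.1)) (lt_of_le_of_ne c1.1 c2.2)

/-- A two-sided test that does not always reject can be written, up to a null set, as an interval
rule whose acceptance interval is nondegenerate, unless it accepts only at a non-isolated atom. -/
lemma exists_intervalRule_power_eq (hh0 : ∀ y, 0 ≤ h y) {δ : Y → ℝ} {ℓ u : EReal} (hle : ℓ ≤ u)
    (h1 : ∀ y, (T y : EReal) < ℓ ∨ u < (T y : EReal) → δ y = 1)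
    (h0 : ∀ y, ℓ < (T y : EReal) → (T y : EReal) < u → δ y = 0)
    (hne : μ {y | 0 < h y ∧ δ y ≠ 1} ≠ 0) :
    ∃ (ℓ' u' : EReal),
      (ℓ' < u' ∨ ∃ t : ℝ, ℓ' = (t : EReal) ∧ u' = (t : EReal) ∧ IsNonisolatedAtom μ h T t) ∧
      power μ (expDensity μ h T) (intervalRule T ℓ' u' δ) = power μ (expDensity μ h T) δ := by
  rcases hle.lt_or_eq with hlt | rfl
  · exact ⟨ℓ, u, .inl hlt, by rw [← intervalRule_self h1 h0]⟩
  induction ℓ using EReal.rec with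
  | bot =>
    refine absurd ?_ hne
    simp [h1 _ (.inr (EReal.bot_lt_coe _))]
  | top =>
    refine absurd ?_ hne
    simp [h1 _ (.inl (EReal.coe_lt_top _))]
  | coe t =>
    have ht1 : ∀ y, T y ≠ t → δ y = 1 := fun y hy =>
      h1 y (by simpa using lt_or_gt_of_ne hy)
    by_cases hat : IsNonisolatedAtom μ h T t
    · exact ⟨t, t, .inr ⟨t, rfl, rfl, hat⟩, by rw [← intervalRule_self h1 h0]⟩
    -- Acceptance is possible only at `T = t`, so that event is not null.
    have hatom : 0 < μ {y | 0 < h y ∧ T y = t} := by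
      refine pos_iff_ne_zero.2 fun hz => hne (measure_mono_null ?_ hz)
      rintro y ⟨hy, hy1⟩
      exact ⟨hy, by_contra fun hyt => hy1 (ht1 y hyt)⟩
    simp only [IsNonisolatedAtom, hatom, true_and, not_forall, not_and_or, not_lt,
      nonpos_iff_eq_zero] at hat
    -- The acceptance interval is extended over the null gap beside `t`. Using `δ` itself for the
    -- randomization keeps its value at `t` and gives `1` at the new end.
    obtain ⟨ε, hε, hnull | hnull⟩ := hat
    · refine ⟨((t - ε : ℝ) : EReal), t, .inl (EReal.coe_lt_coe_iff.2 (by linarith)), ?_⟩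
      refine power_expDensity_congr (measure_mono_null ?_ hnull) hh0
      rintro y ⟨hy, hyne⟩
      refine ⟨hy, ?_⟩
      by_contra hout
      apply hyne
      unfold intervalRule
      simp only [EReal.coe_lt_coe_iff, EReal.coe_eq_coe_iff]
      split_ifs with c1 c2
      · exact (ht1 y (by rintro rfl; rcases c1 with c | c <;> linarith)).symm
      · rfl
      · simp only [not_or, not_lt] at c1 c2
        exact absurd ⟨lt_of_le_of_ne c1.2 (Ne.symm c2.1), lt_of_le_of_ne c1.1 c2.2⟩ hout
    · refine ⟨t, ((t + ε : ℝ) : EReal), .inl (EReal.coe_lt_coe_iff.2 (by linarith)), ?_⟩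
      refine power_expDensity_congr (measure_mono_null ?_ hnull) hh0
      rintro y ⟨hy, hyne⟩
      refine ⟨hy, ?_⟩
      by_contra hout
      apply hyne
      unfold intervalRule
      simp only [EReal.coe_lt_coe_iff, EReal.coe_eq_coe_iff]
      split_ifs with c1 c2
      · exact (ht1 y (by rintro rfl; rcases c1 with c | c <;> linarith)).symm
      · rfl
      · simp only [not_or, not_lt] at c1 c2
        exact absurd ⟨lt_of_le_of_ne c1.2 (Ne.symm c2.1), lt_of_le_of_ne c1.1 c2.2⟩ hout

end ExponentialFamily

/-! ### Existence of an optimal interval rule. -/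

/-- Some two-sided test is optimal and exhausts the level at an endpoint of the null hypothesis. -/
theorem exists_twoSided_isOptimal {Y : Type*} [MeasurableSpace Y] {μ : Measure Y}
    {h T : Y → ℝ} (hh : Measurable h) (hh0 : ∀ y, 0 ≤ h y)
    (hne : ¬ (∀ᵐ y ∂μ, h y = 0)) (hT : Measurable T)
    {a b K : ℝ} (hab : a ≤ b) (ha : a ∈ Ioo (-K) K) (hb : b ∈ Ioo (-K) K)
    (hΘ : Icc (-K) K ⊆ expDomain μ h T) {α : ℝ} (hα : α ∈ Ioo (0 : ℝ) 1)
    {g : ℝ → ℝ} (hg : ContinuousOn g (Icc 0 1)) (hgm : StrictMonoOn g (Icc 0 1))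
    (Λ : Measure ℝ) [IsFiniteMeasure Λ] (hΛ : Λ (Icc (-K) K \ Icc a b) ≠ 0) :
    ∃ δ : Y → ℝ,
      IsOptimal μ (expDensity μ h T) g (Icc a b) (Icc (-K) K \ Icc a b) Λ α δ ∧
      worstFalseAlarm μ (expDensity μ h T) (Icc a b) δ = α ∧
      max (power μ (expDensity μ h T) δ a) (power μ (expDensity μ h T) δ b) = α ∧
      ∃ ℓ u : EReal, ℓ ≤ u ∧
        (∀ y, (T y : EReal) < ℓ ∨ u < (T y : EReal) → δ y = 1) ∧
        ∀ y, ℓ < (T y : EReal) → (T y : EReal) < u → δ y = 0 := by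
  set m := carrier μ h with hm
  have : NeZero m := neZero_carrier hh hh0 hne
  have hE : ∀ θ ∈ Icc (-K) K, Integrable (fun y => Real.exp (θ * T y)) m := fun θ hθ =>
    (integrable_carrier_iff hh hh0 _).2 (hΘ hθ)
  have hK : 0 ≤ K := by linarith [ha.1, ha.2]
  have ha' := Ioo_subset_Icc_self ha
  have hb' := Ioo_subset_Icc_self hb
  have habK : Icc a b ⊆ Icc (-K) K := Icc_subset_Icc ha'.1 hb'.2
  have := isProbabilityMeasure_tilted (hE a ha')
  obtain ⟨U, hU⟩ := exists_isStepFamily (m.tilted fun y => a * T y) hT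
  set S := Icc (-K) K \ Icc a b with hS
  have hSm : MeasurableSet S := measurableSet_Icc.diff measurableSet_Icc
  have hSK : S ⊆ Icc (-K) K := sdiff_subset
  set D : ℝ × ℝ → Y → ℝ := fun q => twoSided T U q.1 q.2 with hD
  have hDr : ∀ q ∈ sizePairs, IsDecisionRule (D q) := fun q hq => hU.isDecisionRule_twoSided hT hq
  have hpc : ∀ δ : Y → ℝ, IsDecisionRule δ → ContinuousOn (tiltedPower m T δ) (Icc (-K) K) :=
    fun δ hδ => continuousOn_tiltedPower hE hK hT hδ
  have hp1 : ∀ δ : Y → ℝ, IsDecisionRule δ → ∀ θ ∈ Icc (-K) K,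
      tiltedPower m T δ θ ∈ Icc (0 : ℝ) 1 := fun δ hδ θ hθ => tiltedPower_mem_Icc hδ (hE θ hθ)
  have hDc : ∀ θ ∈ Icc (-K) K, ContinuousOn (fun q => tiltedPower m T (D q) θ) sizePairs :=
    fun θ hθ => continuousOn_tiltedPower_twoSided hE hT ha' hU hθ
  have hne' : (Icc a b).Nonempty := nonempty_Icc.2 hab
  have hbdd : ∀ δ : Y → ℝ, IsDecisionRule δ → BddAbove (tiltedPower m T δ '' Icc a b) := by
    rintro δ hδ
    refine ⟨1, ?_⟩
    rintro _ ⟨θ, hθ, rfl⟩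
    exact (hp1 δ hδ θ (habK hθ)).2
  -- By quasi-convexity these are the pairs whose test is feasible; the pair `(0, 1)`, which never
  -- rejects, is one of them.
  set A : Set (ℝ × ℝ) := sizePairs ∩
    (fun q => max (tiltedPower m T (D q) a) (tiltedPower m T (D q) b)) ⁻¹' Iic α with hA
  have hAc : IsCompact A :=
    isCompact_sizePairs.of_isClosed_subset (((hDc a ha').sup (hDc b hb')).preimage_isClosed_of_isClosed
      isCompact_sizePairs.isClosed isClosed_Iic) inter_subset_left
  have hAne : A.Nonempty := by
    refine ⟨(0, 1), ⟨le_rfl, zero_le_one, le_rfl⟩, ?_⟩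
    have h0 : D (0, 1) = fun _ => 0 := by
      funext y; simp [hD, twoSided, hU.zero, hU.one]
    simp [h0, tiltedPower, hα.1.le]
  obtain ⟨q, ⟨hq, hqα⟩, hmax⟩ := hAc.exists_isMaxOn hAne
    ((continuousOn_setIntegral_utility (Λ := Λ) hg hSm hSK (fun q hq => hpc _ (hDr q hq))
      (fun q hq => hp1 _ (hDr q hq)) hDc).mono inter_subset_left)
  have hqr := hDr q hq
  obtain ⟨ℓ, u, hle, ho, hi⟩ := hU.exists_thresholds hq
  have hquasi : ∀ θ ∈ Icc a b, tiltedPower m T (D q) θ ≤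
      max (tiltedPower m T (D q) a) (tiltedPower m T (D q) b) := fun θ hθ =>
    tiltedPower_le_max_endpoints hE ha' hb' hqr hle ho hi hθ
  have hopt : IsOptimal μ (expDensity μ h T) g (Icc a b) S Λ α (D q) := by
    simp only [IsOptimal, IsFeasible, worstFalseAlarm, objective, power_expDensity_eq hh hh0]
    refine ⟨⟨hqr, csSup_le (hne'.image _) ?_⟩, fun φ hφ => ?_⟩
    · rintro _ ⟨θ, hθ, rfl⟩
      exact (hquasi θ hθ).trans hqα
    · obtain ⟨q', hq', hqa, hqb, hdom⟩ :=
        exists_twoSided_dominating hE hT hab ha hb hU hφ.1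
      have hle' : ∀ θ ∈ Icc a b, tiltedPower m T φ θ ≤ α := fun θ hθ =>
        (le_csSup (hbdd φ hφ.1) (mem_image_of_mem _ hθ)).trans hφ.2
      have hqA : q' ∈ A := ⟨hq', by
        simp only [hD, mem_preimage, mem_Iic, hqa, hqb]
        exact max_le (hle' a (left_mem_Icc.2 hab)) (hle' b (right_mem_Icc.2 hab))⟩
      exact (setIntegral_utility_mono hg hgm hSm hSK (hpc φ hφ.1) (hp1 φ hφ.1)
        (hpc _ (hDr q' hq')) (hp1 _ (hDr q' hq')) fun θ hθ => hdom θ hθ.1 hθ.2).trans (hmax hqA)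
  have hmaxα : max (tiltedPower m T (D q) a) (tiltedPower m T (D q) b) = α := by
    refine le_antisymm hqα (not_lt.1 fun hlt => ?_)
    set M := max (tiltedPower m T (D q) a) (tiltedPower m T (D q) b) with hM
    -- Mixing with the rule `1` at weight `ε` gives power at most `M + ε * (1 - M) ≤ α` on the null
    -- and strictly raises the power on `S`, where it is below `1`.
    set ε := α - M with hε
    have hε0 : 0 < ε := sub_pos.2 hlt
    have hM0 : 0 ≤ M := le_max_of_le_left (hp1 _ hqr a ha').1
    have hε1 : ε ≤ 1 := by linarith [hα.2]
    set φ : Y → ℝ := fun y => D q y + ε * (1 - D q y) with hφ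
    have hφr : IsDecisionRule φ :=
      ⟨hqr.1.add (measurable_const.mul (measurable_const.sub hqr.1)), fun y =>
        ⟨by nlinarith [(hqr.2 y).1, (hqr.2 y).2], by nlinarith [(hqr.2 y).1, (hqr.2 y).2]⟩⟩
    have hφp : ∀ θ ∈ Icc (-K) K, tiltedPower m T φ θ =
        tiltedPower m T (D q) θ + ε * (1 - tiltedPower m T (D q) θ) := fun θ hθ =>
      tiltedPower_convex_one hqr (hE θ hθ) ε
    have hφf : IsFeasible μ (expDensity μ h T) (Icc a b) α φ := by
      refine ⟨hφr, ?_⟩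
      rw [worstFalseAlarm, power_expDensity_eq hh hh0]
      refine csSup_le (hne'.image _) ?_
      rintro _ ⟨θ, hθ, rfl⟩
      rw [hφp θ (habK hθ)]
      nlinarith [hquasi θ hθ]
    have hle' := hopt.2 φ hφf
    simp only [objective, power_expDensity_eq hh hh0] at hle'
    refine absurd hle' (not_le.2 (setIntegral_utility_lt hg hgm hSm hSK hΛ (hpc _ hqr)
      (hp1 _ hqr) (hpc _ hφr) (hp1 _ hφr) fun θ hθ => ?_))
    rw [hφp θ (hSK hθ)]
    have hlt1 := tiltedPower_lt_one hqr (hE θ (hSK hθ)) (hE a ha')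
      (lt_of_le_of_lt (le_max_left _ (tiltedPower m T (D q) b)) (hlt.trans hα.2))
    nlinarith
  refine ⟨D q, hopt, le_antisymm hopt.1.2 ?_, ?_, ℓ, u, hle, ho, hi⟩
  · rw [worstFalseAlarm, power_expDensity_eq hh hh0]
    rw [← hmaxα]
    exact max_le (le_csSup (hbdd _ hqr) (mem_image_of_mem _ (left_mem_Icc.2 hab)))
      (le_csSup (hbdd _ hqr) (mem_image_of_mem _ (right_mem_Icc.2 hab)))
  · rwa [power_expDensity_eq hh hh0]

end CompositeTest

theorem theorem6 {Y : Type*} [MeasurableSpace Y] (μ : Measure Y) [SigmaFinite μ]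
    (h T : Y → ℝ) (hh : Measurable h) (hh_nonneg : ∀ y, 0 ≤ h y)
    (hh_ne : ¬ (∀ᵐ y ∂μ, h y = 0)) (hT : Measurable T)
    (hD : IsOpen (expDomain μ h T))
    (a b K : ℝ) (hab : a ≤ b) (hK : max |a| |b| < K)
    (hΘ : Icc (-K) K ⊆ expDomain μ h T)
    (α : ℝ) (hα : α ∈ Ioo (0 : ℝ) 1)
    (g : ℝ → ℝ) (hg_cont : ContinuousOn g (Icc 0 1)) (hg_diff : ContDiffOn ℝ 1 g (Ioo 0 1))
    (hg_deriv : ∀ t ∈ Ioo (0 : ℝ) 1, 0 < deriv g t)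
    (Λ₁ : Measure ℝ) [IsProbabilityMeasure Λ₁] (hΛ₁ : Λ₁ (Icc (-K) K \ Icc a b)ᶜ = 0)
    (hT_values : ∀ c₁ c₂ : ℝ, 0 < μ {y | T y ∉ ({c₁, c₂} : Set ℝ)}) :
    ∃ δ : Y → ℝ,
      IsOptimal μ (expDensity μ h T) g (Icc a b) (Icc (-K) K \ Icc a b) Λ₁ α δ ∧
      worstFalseAlarm μ (expDensity μ h T) (Icc a b) δ = α ∧
      max (power μ (expDensity μ h T) δ a) (power μ (expDensity μ h T) δ b) = α ∧
      ∃ (ℓ u : EReal) (γ : Y → ℝ),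
        (ℓ < u ∨ ∃ t : ℝ, ℓ = (t : EReal) ∧ u = (t : EReal) ∧ IsNonisolatedAtom μ h T t) ∧
        IsDecisionRule γ ∧
        δ = intervalRule T ℓ u γ := by
  have ha : a ∈ Ioo (-K) K := abs_lt.1 ((le_max_left _ _).trans_lt hK)
  have hb : b ∈ Ioo (-K) K := abs_lt.1 ((le_max_right _ _).trans_lt hK)
  have hgm : StrictMonoOn g (Icc 0 1) :=
    strictMonoOn_of_deriv_pos (convex_Icc 0 1) hg_cont (by rwa [interior_Icc])
  have hΛ : Λ₁ (Icc (-K) K \ Icc a b) ≠ 0 := by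
    rw [(prob_compl_eq_zero_iff (measurableSet_Icc.diff measurableSet_Icc)).1 hΛ₁]
    exact one_ne_zero
  obtain ⟨δ, hopt, hworst, hmax, ℓ, u, hle, h1, h0⟩ :=
    exists_twoSided_isOptimal hh hh_nonneg hh_ne hT hab ha hb hΘ hα hg_cont hgm Λ₁ hΛ
  -- A rule that almost surely rejects would have power `1 > α` at `a` and `b`.
  have hne : μ {y | 0 < h y ∧ δ y ≠ 1} ≠ 0 := by
    intro hz
    have : NeZero (carrier μ h) := neZero_carrier hh hh_nonneg hh_ne
    have hone : ∀ θ ∈ Icc (-K) K, power μ (expDensity μ h T) δ θ = 1 := by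
      intro θ hθ
      have hE : Integrable (fun y => Real.exp (θ * T y)) (carrier μ h) :=
        (integrable_carrier_iff hh hh_nonneg _).2 (hΘ hθ)
      rw [power_expDensity_congr (δ' := fun _ => 1) hz hh_nonneg,
        power_expDensity_eq hh hh_nonneg, tiltedPower]
      simp only [one_mul]
      exact inv_mul_cancel₀ (integral_exp_pos hE).ne'
    rw [hone a (Ioo_subset_Icc_self ha), hone b (Ioo_subset_Icc_self hb), max_self] at hmax
    exact hα.2.ne hmax.symm
  obtain ⟨ℓ', u', hcase, hpow⟩ :=
    exists_intervalRule_power_eq hh_nonneg hle h1 h0 hne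
  refine ⟨intervalRule T ℓ' u' δ, ?_, ?_, ?_, ℓ', u', δ, hcase, hopt.1.1, rfl⟩
  · refine ⟨⟨isDecisionRule_intervalRule hT ℓ' u' hopt.1.1, ?_⟩, fun φ hφ => ?_⟩
    · rw [worstFalseAlarm, hpow]; exact hopt.1.2
    · rw [objective, objective, hpow]; exact hopt.2 φ hφ
  · rw [worstFalseAlarm, hpow]; exact hworst
  · rw [hpow]; exact hmax
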